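/- Let $G$ be a maximal planar graph, that is, a finite simple connected graph embedded in the plane (sphere) so that every face is bounded by a triangle; let $\mathcal F(G)$ be its set of faces. For a connected pseudograph $H$ (loops and multiple edges allowed) with edge weights $x_e\in\mathbb F_3$ put $s(H;x)=\sum_T\prod_{e\in E(T)}x_e$, the sum being over all spanning trees $T$ of $H$. For $W\subseteq V(G)$ let $G/W$ be the pseudograph obtained from $G$ by merging all vertices of $W$ into one vertex (all edges are kept, with their weights). For $x\in\mathbb F_3^{E(G)}$ let $W^*(x)$ be any set $W\subseteq V(G)$ of minimal cardinality such that $s(G/W;x)\neq 0$, and put $$w_G(x)=\left(\frac{s(G/W^*(x);x)}{3}\right)\Big/(-3)^{(|V(G/W^*(x))|-1)/2},\qquad \sqrt{-3}:=-i\sqrt3,$$ where $\left(\frac{\cdot}{3}\right)$ is the Legendre symbol. For $\alpha\in\{1,-1\}^{\mathcal F(G)}\subset\mathbb F_3^{\mathcal F(G)}$ define $x(\alpha)\in\mathbb F_3^{E(G)}$ by $x(\alpha)_e=\alpha(F'_e)+\alpha(F''_e)$, where $F'_e,F''_e$ are the two faces containing the edge $e$. A Tait coloring of $G$ is a coloring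 of the edges of $G$ in three colors such that different edges of one and the same face have different colors; let $\mathrm{Tait}(G)$ be the number of Tait colorings. Then for every $x\in\mathbb F_3^{E(G)}$ a set $W^*(x)$ exists, and neither $|V(G/W^*(x))|$ nor $w_G(x)$ depends on its choice. Moreover $$\frac{\mathrm{Tait}(G)}{3}=\sum_{\alpha} w_G(x(\alpha)),$$ where the sum is over all $\alpha\in\{1,-1\}^{\mathcal F(G)}$ such that $G/W^*(x(\alpha))$ has an odd number of vertices; this holds for every choice of the sets $W^*(x(\alpha))$. -/

import Mathlib

open scoped Graph

namespace TaitAlpha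

/-! ### Spanning-tree sums of pseudographs (Mathlib's multigraphs `Graph α β`) -/

section Pseudograph

variable {α β : Type*}

/-- Two vertices are joined by a walk. -/
def Joined (H : Graph α β) (u v : α) : Prop := Relation.ReflTransGen H.Adj u v

/-- A pseudograph is connected: it has a vertex, and any two vertices are joined by a walk. -/
def IsConnected (H : Graph α β) : Prop :=
  V(H).Nonempty ∧ ∀ u ∈ V(H), ∀ v ∈ V(H), Joined H u v

/-- A pseudograph has no cycles: no edge `e` lies on a cycle, i.e. the ends of `e` are not joined
by a walk that avoids `e`. (Loops and pairs of parallel edges count as cycles.) -/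
def IsAcyclic (H : Graph α β) : Prop :=
  ∀ e u v, H.IsLink e u v → ¬ Joined (H.deleteEdges {e}) u v

/-- A spanning tree of `H`, given by its set of edges. -/
def IsSpanningTree (H : Graph α β) (T : Finset β) : Prop :=
  (T : Set β) ⊆ E(H) ∧ IsConnected (H.restrict T) ∧ IsAcyclic (H.restrict T)

open Classical in
/-- The sum `s(H; x)` over the spanning trees `T` of `H` of the products of the weights `x e` of
the edges of `T`. -/
noncomputable def treeSum [Fintype β] (H : Graph α β) (x : β → ZMod 3) : ZMod 3 :=
  ∑ T : Finset β with IsSpanningTree H T, ∏ e ∈ T, x e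

end Pseudograph

/-! ### Contraction of a vertex set, minimal contractions and the weight -/

section Weight

variable {V : Type*}

/-- Identify all the vertices of `W` with each other, and no others. -/
def contractSetoid (W : Finset V) : Setoid V where
  r u v := u = v ∨ (u ∈ W ∧ v ∈ W)
  iseqv :=
    { refl := fun _ => Or.inl rfl
      symm := by
        rintro u v (h | ⟨h, h'⟩)
        · exact Or.inl h.symm
        · exact Or.inr ⟨h', h⟩
      trans := by
        rintro u v w (rfl | ⟨h, h'⟩) (rfl | ⟨k, k'⟩)
        · exact Or.inl rfl
        · exact Or.inr ⟨k, k'⟩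
        · exact Or.inr ⟨h, h'⟩
        · exact Or.inr ⟨h, k'⟩ }

/-- The pseudograph `G/W`: all the vertices of `W` are merged into one. Its edges are the edges of
`G`, so that loops and parallel edges may occur. -/
def contract (G : SimpleGraph V) (W : Finset V) :
    Graph (Quotient (contractSetoid W)) (Sym2 V) :=
  (Graph.ofSimpleGraph G).map (Quotient.mk (contractSetoid W))

/-- `|V(G/W)|`. -/
noncomputable def contractOrder (G : SimpleGraph V) (W : Finset V) : ℕ := V(contract G W).ncard

variable [Fintype V]

/-- `W` is a possible choice of `W^*(x)`: a set of vertices with the least number of elements such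
that `s(G/W; x) ≠ 0`. The values of `x` outside the edges of `G` play no role. -/
def IsMinContraction (G : SimpleGraph V) (x : Sym2 V → ZMod 3) (W : Finset V) : Prop :=
  treeSum (contract G W) x ≠ 0 ∧
    ∀ W' : Finset V, treeSum (contract G W') x ≠ 0 → W.card ≤ W'.card

/-- The weight `w_G(x)`, computed with `W` as the choice of `W^*(x)`: the Legendre symbol of
`s(G/W; x)` divided by `(-3) ^ ((|V(G/W)| - 1) / 2)`, where the square root of `-3` is `-i √3`. -/
noncomputable def weight (G : SimpleGraph V) (x : Sym2 V → ZMod 3) (W : Finset V) : ℂ :=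
  (quadraticChar (ZMod 3) (treeSum (contract G W) x) : ℂ) /
    (-Complex.I * (Real.sqrt 3 : ℂ)) ^ (contractOrder G W - 1)

end Weight

/-! ### Plane triangulations, Tait colorings and edge weights -/

/-- A rotation system on a simple graph `G`, i.e. (up to homeomorphism) a cellular embedding of a
connected graph `G` in a closed oriented surface: `rot` permutes cyclically, for every
vertex `v`, the darts (oriented edges) that leave `v`. -/
structure RotationSystem {V : Type*} (G : SimpleGraph V) where
  /-- The next dart in the rotation around the source of a dart. -/
  rot : Equiv.Perm G.Dart
  /-- The cycles of `rot` are the sets of all darts with a common source. -/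
  sameCycle_rot_iff : ∀ d d' : G.Dart, rot.SameCycle d d' ↔ d.fst = d'.fst

namespace RotationSystem

variable {V : Type*} {G : SimpleGraph V} (R : RotationSystem G)

/-- The next dart along the boundary of the face on a fixed side of a dart: pass to the
opposite dart, then rotate around its source. -/
def faceNext : Equiv.Perm G.Dart :=
  (SimpleGraph.Dart.symm_involutive (G := G)).toPerm.trans R.rot

/-- The faces are the orbits of `faceNext`. -/
def Face : Type _ := Quotient (Equiv.Perm.SameCycle.setoid R.faceNext)

/-- The face on the fixed side of a dart; the two faces that contain an edge are the faces of its
two darts. -/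
def face (d : G.Dart) : R.Face := Quotient.mk (Equiv.Perm.SameCycle.setoid R.faceNext) d

instance [Finite V] : Finite G.Dart :=
  Finite.of_injective SimpleGraph.Dart.toProd SimpleGraph.Dart.toProd_injective

instance [Finite V] : Finite R.Face :=
  inferInstanceAs (Finite (Quotient (Equiv.Perm.SameCycle.setoid R.faceNext)))

noncomputable instance [Finite V] : Fintype R.Face := Fintype.ofFinite _

noncomputable instance : DecidableEq R.Face := Classical.decEq _

/-- The rotation system is an embedding of the connected graph `G` in the sphere (equivalently, the
plane): Euler's formula `|V| - |E| + |F| = 2` holds. -/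
def IsPlanar : Prop :=
  G.Connected ∧ Nat.card V + Nat.card R.Face = Nat.card G.edgeSet + 2

/-- The embedding makes `G` a maximal planar graph: it is a plane embedding in which the
boundary of each face is a triangle, i.e. is traversed in three steps. (The graph is simple, so the
three edges then form a 3-cycle.) -/
def IsPlaneTriangulation : Prop :=
  R.IsPlanar ∧ ∀ F : R.Face, {d : G.Dart | R.face d = F}.ncard = 3

/-- A Tait coloring: the edges get three colors such that different edges of one and the same
face are colored differently. -/
def IsTaitColoring (c : G.edgeSet → Fin 3) : Prop :=
  ∀ d d' : G.Dart, R.face d = R.face d' → d.edge ≠ d'.edge →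
    c ⟨d.edge, d.edge_mem⟩ ≠ c ⟨d'.edge, d'.edge_mem⟩

/-- The number of Tait colorings. -/
noncomputable def tait : ℕ := Nat.card {c : G.edgeSet → Fin 3 // R.IsTaitColoring c}

open Classical in
/-- The vector `x(α)`: `x_e = α(F'_e) + α(F''_e)`, where `F'_e` and `F''_e` are the faces of the two
darts of the edge `e`. (Pairs of vertices that are not edges get the irrelevant value `0`.) -/
noncomputable def edgeWeight [Fintype V] (α : R.Face → (ZMod 3)ˣ) (e : Sym2 V) : ZMod 3 :=
  ∑ d : G.Dart with d.edge = e, (α (R.face d) : ZMod 3)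

end RotationSystem

end TaitAlpha

/-! The weight `weight G x W` is a normalized quadratic Gauss sum in disguise. Let L be the weighted
Laplacian of G over the field with three elements. By the matrix-tree theorem (`treeSum_contract`),
s(G/W; x) is the principal minor of L with the rows and columns of W deleted, for nonempty W. A
minimal W thus gives a nonzero principal minor of maximal size; its Schur complement vanishes, and
completing the square (`sum_ψ_quadratic`) gives w_G(x) = 3^(-|V|) Σ_y ψ(yᵀLy)
(`IsMinContraction.weight_eq`). The right side does not involve W.

For x = x(α) the form yᵀLy splits over the faces: a face with values a, b, c of y contributes
α(F)((a-b)² + (b-c)² + (c-a)²) = -α(F)(a+b+c)² mod 3. Summed over the signs α(F), the square may be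
replaced by a+b+c itself (`sum_units_ψ`), so the quadratic exponent becomes linear in y.
Orthogonality of characters then counts the α whose sum around every vertex is zero
(`sum_gauss_eq_card_heawood`).

By Heawood's argument (`tait_eq`) each such α comes from exactly three Tait colorings: α(F) is the
constant color difference between consecutive edges of F, and a coloring with given differences
exists because the first cohomology of the sphere vanishes. Finally, weights are real when G/W has
an odd number of vertices and purely imaginary otherwise, so the real part of the full sum keeps
only the odd terms. -/

namespace TaitAlpha

set_option linter.unusedSectionVars false

open Matrix Finset

/-! ### Cauchy–Binet over the field with three elements. -/

section CauchyBinet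

variable {m E K : Type*} [Fintype m] [DecidableEq m] [Fintype E] [DecidableEq E]

/-- Expansion of the determinant of a product along the choice functions of its rows. -/
theorem det_mul_eq_sum_choice [CommRing K] (A : Matrix m E K) (B : Matrix E m K) :
    (A * B).det = ∑ f : m → E, (∏ i, A i (f i)) * (B.submatrix f id).det := by
  have h : (A * B) = fun i => ∑ e, A i e • B e := by
    ext i j
    simp [Matrix.mul_apply, Finset.sum_apply]
  change (detRowAlternating : (m → K) [⋀^m]→ₗ[K] K) (A * B) = _
  rw [h]
  change (detRowAlternating : (m → K) [⋀^m]→ₗ[K] K).toMultilinearMap _ = _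
  rw [MultilinearMap.map_sum]
  refine Finset.sum_congr rfl fun f _ => ?_
  rw [MultilinearMap.map_smul_univ]
  rfl

/-- The evaluation of vectors on the columns in `T`. -/
def columnMap [CommRing K] (N : Matrix m E K) (T : Finset E) : (m → K) →ₗ[K] (T → K) :=
  (N.submatrix id (Subtype.val : T → E)).vecMulLinear

theorem columnMap_apply [CommRing K] (N : Matrix m E K) (T : Finset E) (y : m → K) (e : T) :
    columnMap N T y e = ∑ i, y i * N i e := rfl

/-- The dimensions agree, so injectivity suffices, and transport along `σ` turns the map into row
multiplication by a square matrix. Bijectivity expresses nonvanishing of the minor without choosing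
`σ`. -/
theorem bijective_columnMap_iff [Field K] (N : Matrix m E K) (T : Finset E) (σ : m ≃ T) :
    Function.Bijective (columnMap N T) ↔ (N.submatrix id fun i => (σ i : E)).det ≠ 0 := by
  have h1 : Function.Bijective (columnMap N T) ↔
      Function.Injective (columnMap N T) := by
    refine ⟨fun h => h.1, fun h => ⟨h, ?_⟩⟩
    refine (LinearMap.injective_iff_surjective_of_finrank_eq_finrank ?_).1 h
    simp [Fintype.card_congr σ]
  have h2 : Function.Injective (columnMap N T) ↔
      Function.Injective (N.submatrix id fun i => (σ i : E)).vecMul := by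
    have : (N.submatrix id fun i => (σ i : E)).vecMul =
        (fun z : T → K => fun i => z (σ i)) ∘ columnMap N T := by
      ext y i
      rfl
    rw [this]
    refine (Function.Injective.of_comp_iff ?_ _).symm
    intro a b hab
    ext t
    simpa using congrFun hab (σ.symm t)
  rw [h1, h2, Matrix.vecMul_injective_iff_isUnit, Matrix.isUnit_iff_isUnit_det, isUnit_iff_ne_zero]

/-- The injective choices with image `T` are `σ` after a permutation π. Each yields the same minor
up to sign π, and the signed products of entries add up to a second copy of that minor.
Non-injective choices repeat a column. -/
theorem sum_choice_of_equiv [CommRing K] (N : Matrix m E K) (x : E → K) (T : Finset E)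
    (σ : m ≃ T) :
    ∑ f : m → E with univ.image f = T,
      (∏ i, N i (f i)) * ((∏ i, x (f i)) * (N.submatrix id f).det) =
    (N.submatrix id fun i => (σ i : E)).det ^ 2 * ∏ e ∈ T, x e := by
  have hx (f : m → E) (hf : univ.image f = T) (hi : Function.Injective f) :
      ∏ i, x (f i) = ∏ e ∈ T, x e := by
    rw [← hf, Finset.prod_image (fun a _ b _ h => hi h)]
  rw [sq, Finset.sum_congr rfl (g := fun f => ((∏ i, N i (f i)) * (N.submatrix id f).det) *
    ∏ e ∈ T, x e), ← Finset.sum_mul]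
  · congr 1
    have key : (N.submatrix id fun i => (σ i : E)).det =
        ∑ π : Equiv.Perm m, (Equiv.Perm.sign π : K) * ∏ i, N i (σ (π i)) := by
      rw [← Matrix.det_transpose, Matrix.det_apply']
      simp
    conv_rhs => lhs; rw [key]
    rw [Finset.sum_mul]
    symm
    refine Finset.sum_bij (fun π _ i => (σ (π i) : E)) ?_ ?_ ?_ ?_
    · intro π _
      simp only [mem_filter, mem_univ, true_and]
      ext e
      simp only [mem_image, mem_univ, true_and]
      constructor
      · rintro ⟨i, rfl⟩
        exact (σ (π i)).2
      · intro he
        exact ⟨π.symm (σ.symm ⟨e, he⟩), by simp⟩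
    · intro π _ π' _ h
      ext i
      have := congrFun h i
      exact σ.injective (Subtype.ext this) ▸ rfl
    · intro f hf
      simp only [mem_filter, mem_univ, true_and] at hf
      have hm (i) : f i ∈ T := hf ▸ mem_image_of_mem f (mem_univ i)
      have hs : Function.Surjective (fun i => σ.symm ⟨f i, hm i⟩) := by
        intro j
        have : (σ j : E) ∈ univ.image f := hf ▸ (σ j).2
        obtain ⟨i, -, hi⟩ := mem_image.1 this
        exact ⟨i, by simp [hi]⟩
      refine ⟨Equiv.ofBijective _ (Finite.injective_iff_bijective.1
        (Finite.injective_iff_surjective.2 hs)), mem_univ _, ?_⟩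
      ext i
      simp
    · intro π _
      have : (N.submatrix id fun i => (σ (π i) : E)).det =
          Equiv.Perm.sign π * (N.submatrix id fun i => (σ i : E)).det := by
        rw [← Matrix.det_permute']
        rfl
      rw [this]
      ring
  · intro f hf
    simp only [mem_filter, mem_univ, true_and] at hf
    by_cases hi : Function.Injective f
    · rw [hx f hf hi]
      ring
    · obtain ⟨a, b, hab, hne⟩ := Function.not_injective_iff.1 hi
      rw [Matrix.det_zero_of_column_eq hne (fun k => by simp [hab])]
      ring

/-- The Cauchy–Binet formula for a Gram matrix with weights, over the field with three elements,
where all nonzero squares are `1`. -/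
theorem det_mul_diagonal_mul_transpose (N : Matrix m E (ZMod 3)) (x : E → ZMod 3)
    [DecidablePred fun T : Finset E => Function.Bijective (columnMap N T)] :
    (N * diagonal x * Nᵀ).det =
      ∑ T : Finset E with Function.Bijective (columnMap N T), ∏ e ∈ T, x e := by
  rw [Matrix.mul_assoc, det_mul_eq_sum_choice, ← Finset.sum_fiberwise univ (fun f => univ.image f),
    Finset.sum_filter]
  refine Finset.sum_congr rfl fun T _ => ?_
  have hd (f : m → E) : ((diagonal x * Nᵀ).submatrix f id).det =
      (∏ i, x (f i)) * (N.submatrix id f).det := by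
    rw [← Matrix.det_transpose (N.submatrix id f), ← Matrix.det_mul_column]
    congr 1
    ext i j
    simp
  simp_rw [hd]
  by_cases hc : Fintype.card m = Fintype.card T
  · obtain ⟨σ⟩ := Fintype.card_eq.1 hc
    rw [sum_choice_of_equiv N x T σ]
    by_cases hb : Function.Bijective (columnMap N T)
    · have h3 : ∀ a : ZMod 3, a ≠ 0 → a ^ 2 = 1 := by decide
      rw [if_pos hb, h3 _ ((bijective_columnMap_iff N T σ).1 hb), one_mul]
    · rw [if_neg hb]
      have : (N.submatrix id fun i => (σ i : E)).det = 0 := by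
        by_contra h
        exact hb ((bijective_columnMap_iff N T σ).2 h)
      simp [this]
  · rw [if_neg]
    · refine Finset.sum_eq_zero fun f hf => ?_
      simp only [mem_filter, mem_univ, true_and] at hf
      have hi : ¬ Function.Injective f := by
        intro hi
        apply hc
        rw [Fintype.card_coe, ← hf, Finset.card_image_of_injective _ hi, Finset.card_univ]
      obtain ⟨a, b, hab, hne⟩ := Function.not_injective_iff.1 hi
      rw [Matrix.det_zero_of_column_eq hne (fun k => by simp [hab])]
      ring
    · intro hb
      have := (LinearEquiv.ofBijective _ hb).finrank_eq
      simp only [Module.finrank_fintype_fun_eq_card] at this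
      exact hc this

end CauchyBinet

/-! ### Quadratic Gauss sums of symmetric matrices. -/

section GaussSum

/-- The additive character `a ↦ exp (2 π i a / 3)`. -/
noncomputable def ψ : AddChar (ZMod 3) ℂ := ZMod.stdAddChar

theorem ψ_one : ψ 1 = -1 / 2 + Complex.I * (Real.sqrt 3 : ℂ) / 2 := by
  have h : ψ 1 = Complex.exp (2 * Real.pi * Complex.I * (1 : ℤ) / (3 : ℕ)) := by
    rw [ψ, ← ZMod.stdAddChar_coe]
    simp
  rw [h, show (2 * Real.pi * Complex.I * (1 : ℤ) / (3 : ℕ) : ℂ) =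
    ((Real.pi - Real.pi / 3 : ℝ) : ℂ) * Complex.I by push_cast; ring, Complex.exp_mul_I,
    ← Complex.ofReal_cos, ← Complex.ofReal_sin, Real.cos_pi_sub, Real.sin_pi_sub,
    Real.cos_pi_div_three, Real.sin_pi_div_three]
  push_cast
  ring

theorem sqrt_three_sq : (Real.sqrt 3 : ℂ) ^ 2 = 3 := by
  rw [← Complex.ofReal_pow, Real.sq_sqrt (by norm_num)]
  norm_num

theorem ψ_two : ψ 2 = -1 / 2 - Complex.I * (Real.sqrt 3 : ℂ) / 2 := by
  have h : ψ 2 = ψ 1 * ψ 1 := by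
    rw [← AddChar.map_add_eq_mul]
    rfl
  rw [h, ψ_one]
  linear_combination (-1 / 4 : ℂ) * sqrt_three_sq +
    ((Real.sqrt 3 : ℂ) ^ 2 / 4) * Complex.I_sq

/-- Both nonzero `t` have square 1, so the sum is 1 + 2ψ(a). -/
theorem sum_ψ_mul_sq (a : ZMod 3) (ha : a ≠ 0) :
    ∑ t : ZMod 3, ψ (a * t ^ 2) = quadraticChar (ZMod 3) a * (Complex.I * (Real.sqrt 3 : ℂ)) := by
  have h : ∀ f : ZMod 3 → ℂ, ∑ t, f t = f 0 + f 1 + f 2 := Fin.sum_univ_three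
  have h1 : quadraticChar (ZMod 3) 1 = 1 := by simp
  have h2 : quadraticChar (ZMod 3) 2 = -1 := by decide
  have h3 : a = 1 ∨ a = 2 := by revert a; decide
  rw [h]
  rcases h3 with rfl | rfl
  · rw [h1, show (1 * 0 ^ 2 : ZMod 3) = 0 from rfl, show (1 * 1 ^ 2 : ZMod 3) = 1 from rfl,
      show (1 * 2 ^ 2 : ZMod 3) = 1 from rfl, AddChar.map_zero_eq_one, ψ_one]
    push_cast
    ring
  · rw [h2, show (2 * 0 ^ 2 : ZMod 3) = 0 from rfl, show (2 * 1 ^ 2 : ZMod 3) = 2 from rfl,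
      show (2 * 2 ^ 2 : ZMod 3) = 2 from rfl, AddChar.map_zero_eq_one, ψ_two]
    push_cast
    ring

theorem ψ_sum {ι : Type*} (s : Finset ι) (f : ι → ZMod 3) : ψ (∑ i ∈ s, f i) = ∏ i ∈ s, ψ (f i) := by
  classical
  induction s using Finset.induction_on with
  | empty => simp
  | insert a s ha ih => rw [sum_insert ha, prod_insert ha, AddChar.map_add_eq_mul, ih]

variable {m n V : Type*} [Fintype m] [DecidableEq m] [Fintype n] [DecidableEq n]
  [Fintype V] [DecidableEq V]

/-- A symmetric matrix over the field with three elements is congruent to a diagonal matrix. -/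
theorem exists_congruent_diagonal (A : Matrix m m (ZMod 3)) (hA : A.IsSymm) :
    ∃ (P : Matrix m m (ZMod 3)) (d : m → ZMod 3), P.det ≠ 0 ∧ Pᵀ * A * P = diagonal d := by
  -- Orthogonal bases of symmetric forms need 2 invertible; mod 3 it is its own inverse.
  have : Invertible (2 : ZMod 3) := ⟨2, rfl, rfl⟩
  have hs : LinearMap.IsSymm (Matrix.toBilin' A) := by
    refine ⟨fun x y => ?_⟩
    rw [RingHom.id_apply, Matrix.toBilin'_apply', Matrix.toBilin'_apply', dotProduct_mulVec,
      ← mulVec_transpose, hA.eq, dotProduct_comm]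
  obtain ⟨v, hv⟩ := LinearMap.BilinForm.exists_orthogonal_basis hs
  have hc : Module.finrank (ZMod 3) (m → ZMod 3) = Fintype.card m := by simp
  let w := v.reindex (finCongr hc |>.trans (Fintype.equivFin m).symm)
  have hw : (Matrix.toBilin' A).IsOrthoᵢ w := by
    intro i j hij
    simp only [w, Module.Basis.reindex_apply, Function.onFun]
    exact hv fun h => hij (by simpa using h)
  refine ⟨Matrix.of fun i j => w j i, fun i => Matrix.toBilin' A (w i) (w i), ?_, ?_⟩
  · have hu : IsUnit (Matrix.of fun i j => w j i) := by
      rw [← Matrix.linearIndependent_cols_iff_isUnit]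
      exact w.linearIndependent
    exact ((Matrix.isUnit_iff_isUnit_det _).1 hu).ne_zero
  · ext i j
    have h : (((Matrix.of fun i j => w j i)ᵀ * A * Matrix.of fun i j => w j i) :
        Matrix m m (ZMod 3)) i j = Matrix.toBilin' A (w i) (w j) := by
      rw [Matrix.toBilin'_apply', Matrix.mul_assoc]
      rfl
    rw [h, diagonal_apply]
    split_ifs with hij
    · rw [hij]
    · exact hw hij

/-- The quadratic Gauss sum of a nondegenerate symmetric matrix. -/
theorem sum_ψ_quadratic_of_det_ne_zero (A : Matrix m m (ZMod 3)) (hA : A.IsSymm) (hd : A.det ≠ 0) :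
    ∑ y : m → ZMod 3, ψ (y ⬝ᵥ A *ᵥ y) =
      quadraticChar (ZMod 3) A.det * (Complex.I * (Real.sqrt 3 : ℂ)) ^ Fintype.card m := by
  obtain ⟨P, d, hP, hPd⟩ := exists_congruent_diagonal A hA
  have hdet : A.det * P.det ^ 2 = ∏ i, d i := by
    rw [← det_diagonal, ← hPd, det_mul, det_mul, det_transpose]
    ring
  have hdi (i) : d i ≠ 0 := by
    intro h
    have : ∏ i, d i = 0 := prod_eq_zero (mem_univ i) h
    rw [← hdet] at this
    exact mul_ne_zero hd (pow_ne_zero 2 hP) this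
  -- The determinant of the base change enters squared, so the character does not see it.
  have hchar : quadraticChar (ZMod 3) A.det = ∏ i, quadraticChar (ZMod 3) (d i) := by
    rw [← map_prod, ← hdet, map_mul, quadraticChar_sq_one' hP, mul_one]
  have hbij : Function.Bijective P.mulVec := by
    have hu : IsUnit P := (Matrix.isUnit_iff_isUnit_det _).2 (isUnit_iff_ne_zero.2 hP)
    exact ⟨Matrix.mulVec_injective_iff_isUnit.2 hu, Matrix.mulVec_surjective_iff_isUnit.2 hu⟩
  rw [← Function.Bijective.sum_comp hbij (fun y => ψ (y ⬝ᵥ A *ᵥ y))]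
  have hq (c : m → ZMod 3) : ψ ((P *ᵥ c) ⬝ᵥ A *ᵥ (P *ᵥ c)) = ∏ i, ψ (d i * c i ^ 2) := by
    rw [← ψ_sum]
    congr 1
    have hPc : P *ᵥ c = c ᵥ* Pᵀ := (vecMul_transpose _ _).symm
    conv_lhs => rw [dotProduct_comm]; arg 2; rw [hPc]
    rw [dotProduct_comm, ← dotProduct_mulVec, mulVec_mulVec, mulVec_mulVec, hPd]
    simp only [dotProduct, mulVec_diagonal]
    exact sum_congr rfl fun i _ => by ring
  simp_rw [hq]
  have := Finset.prod_univ_sum (fun _ : m => (univ : Finset (ZMod 3)))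
    (fun i t => ψ (d i * t ^ 2))
  rw [Fintype.piFinset_univ] at this
  rw [← this, Finset.prod_congr rfl fun i _ => sum_ψ_mul_sq (d i) (hdi i), prod_mul_distrib,
    prod_const, hchar, card_univ]
  push_cast
  rfl

/-- The quadratic Gauss sum of a symmetric block matrix whose Schur complement vanishes. -/
theorem sum_ψ_quadratic_fromBlocks (A : Matrix m m (ZMod 3)) (B : Matrix m n (ZMod 3))
    (hA : A.IsSymm) (hd : A.det ≠ 0) :
    ∑ y : m ⊕ n → ZMod 3, ψ (y ⬝ᵥ (fromBlocks A B Bᵀ (Bᵀ * A⁻¹ * B)) *ᵥ y) =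
      3 ^ Fintype.card n * (quadraticChar (ZMod 3) A.det *
        (Complex.I * (Real.sqrt 3 : ℂ)) ^ Fintype.card m) := by
  have hu : IsUnit A.det := isUnit_iff_ne_zero.2 hd
  have hAi : (A⁻¹)ᵀ = A⁻¹ := by rw [transpose_nonsing_inv, hA.eq]
  -- Completing the square: the form depends only on u + A⁻¹Bv, so for each fixed v the sum over u
  -- is a translate of the Gauss sum of A.
  have hsq (u : m → ZMod 3) (v : n → ZMod 3) :
      Sum.elim u v ⬝ᵥ (fromBlocks A B Bᵀ (Bᵀ * A⁻¹ * B)) *ᵥ Sum.elim u v =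
        (u + (A⁻¹ * B) *ᵥ v) ⬝ᵥ A *ᵥ (u + (A⁻¹ * B) *ᵥ v) := by
    have e1 : ((A⁻¹ * B) *ᵥ v) ⬝ᵥ A *ᵥ u = v ⬝ᵥ Bᵀ *ᵥ u := by
      rw [← vecMul_transpose, ← dotProduct_mulVec, mulVec_mulVec, transpose_mul, hAi,
        Matrix.mul_assoc, nonsing_inv_mul _ hu, Matrix.mul_one]
    have e2 : A *ᵥ (A⁻¹ * B) *ᵥ v = B *ᵥ v := by
      rw [mulVec_mulVec, ← Matrix.mul_assoc, mul_nonsing_inv _ hu, Matrix.one_mul]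
    have e3 : ((A⁻¹ * B) *ᵥ v) ⬝ᵥ B *ᵥ v = v ⬝ᵥ (Bᵀ * A⁻¹ * B) *ᵥ v := by
      rw [← vecMul_transpose, ← dotProduct_mulVec, mulVec_mulVec, transpose_mul, hAi]
    rw [fromBlocks_mulVec, mulVec_add, add_dotProduct, dotProduct_add, dotProduct_add, e1, e2, e3]
    simp only [sumElim_dotProduct_sumElim, Sum.elim_comp_inl, Sum.elim_comp_inr, dotProduct_add]
  rw [← (Equiv.sumArrowEquivProdArrow m n (ZMod 3)).symm.sum_comp, Fintype.sum_prod_type_right]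
  have : ∀ v : n → ZMod 3, ∑ u : m → ZMod 3,
      ψ ((Equiv.sumArrowEquivProdArrow m n (ZMod 3)).symm (u, v) ⬝ᵥ
        (fromBlocks A B Bᵀ (Bᵀ * A⁻¹ * B)) *ᵥ
          (Equiv.sumArrowEquivProdArrow m n (ZMod 3)).symm (u, v)) =
      quadraticChar (ZMod 3) A.det * (Complex.I * (Real.sqrt 3 : ℂ)) ^ Fintype.card m := by
    intro v
    rw [← sum_ψ_quadratic_of_det_ne_zero A hA hd,
      ← Equiv.sum_comp (Equiv.addRight ((A⁻¹ * B) *ᵥ v)) (fun y => ψ (y ⬝ᵥ A *ᵥ y))]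
    exact sum_congr rfl fun u _ => congrArg ψ (hsq u v)
  rw [sum_congr rfl fun v _ => this v, sum_const, card_univ, nsmul_eq_mul]
  simp

/-- The principal minor of `M` obtained by deleting the rows and columns in `W`. -/
noncomputable def principalMinor {K : Type*} [CommRing K] (M : Matrix V V K) (W : Finset V) : K :=
  (M.submatrix (Subtype.val : {v // v ∉ W} → V) Subtype.val).det

theorem det_submatrix_eq_principalMinor {K : Type*} [CommRing K] (M : Matrix V V K) (W : Finset V)
    (h : m → V) (hi : Function.Injective h) (hW : ∀ v, v ∉ W ↔ ∃ i, h i = v) :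
    (M.submatrix h h).det = principalMinor M W := by
  let e : m ≃ {v // v ∉ W} := Equiv.ofBijective (fun i => ⟨h i, (hW _).2 ⟨i, rfl⟩⟩)
    ⟨fun a b hab => hi (congrArg Subtype.val hab),
      fun ⟨v, hv⟩ => by
        obtain ⟨i, rfl⟩ := (hW v).1 hv
        exact ⟨i, rfl⟩⟩
  rw [principalMinor, ← det_submatrix_equiv_self e]
  rfl

/-- With zero diagonal and symmetry, the 2×2 principal minors are the negated squares of the
off-diagonal entries. -/
theorem matrix_eq_zero_of_principal_minors (S : Matrix n n (ZMod 3)) (hS : S.IsSymm)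
    (h1 : ∀ j, S j j = 0)
    (h2 : ∀ j k, j ≠ k → S j j * S k k - S j k * S k j = 0) : S = 0 := by
  ext j k
  by_cases hjk : j = k
  · rw [hjk, h1]
    rfl
  · have := h2 j k hjk
    rw [h1, hS.apply j k] at this
    simpa using this

/-- The quadratic Gauss sum of a symmetric matrix in terms of a nonzero principal minor of
maximal size. -/
theorem sum_ψ_quadratic (M : Matrix V V (ZMod 3)) (hM : M.IsSymm) (W : Finset V)
    (hW : principalMinor M W ≠ 0)
    (hmax : ∀ W', principalMinor M W' ≠ 0 → W.card ≤ W'.card) :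
    ∑ y : V → ZMod 3, ψ (y ⬝ᵥ M *ᵥ y) =
      3 ^ W.card * (quadraticChar (ZMod 3) (principalMinor M W) *
        (Complex.I * (Real.sqrt 3 : ℂ)) ^ (Fintype.card V - W.card)) := by
  let σ : {v // v ∉ W} ⊕ {v // v ∈ W} ≃ V :=
    (Equiv.sumComm _ _).trans (Equiv.sumCompl (fun v => v ∈ W))
  let i₁ : {v // v ∉ W} → V := Subtype.val
  let i₂ : {v // v ∈ W} → V := Subtype.val
  let A := M.submatrix i₁ i₁
  let B := M.submatrix i₁ i₂
  let D := M.submatrix i₂ i₂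
  have hA : A.IsSymm := hM.submatrix _
  have hd : A.det ≠ 0 := hW
  have hu : IsUnit A.det := isUnit_iff_ne_zero.2 hd
  have : Invertible A := A.invertibleOfIsUnitDet hu
  have hB : M.submatrix i₂ i₁ = Bᵀ := by
    ext j k
    exact hM.apply _ _
  have hblocks : M.submatrix σ σ = fromBlocks A B Bᵀ D := by
    rw [← hB]
    ext (j | j) (k | k) <;> rfl
  -- Restoring some indices of `W` gives a larger principal minor of `M`, which is zero by
  -- maximality. It equals det A times the corresponding principal minor of the Schur complement, so
  -- those minors vanish; sizes 1 and 2 suffice.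
  have hschur : D - Bᵀ * A⁻¹ * B = 0 := by
    have key {κ : Type} [Fintype κ] [DecidableEq κ] [Nonempty κ] (g : κ → {v // v ∈ W})
        (hg : Function.Injective g) : ((D - Bᵀ * A⁻¹ * B).submatrix g g).det = 0 := by
      let h : {v // v ∉ W} ⊕ κ → V := Sum.elim i₁ (i₂ ∘ g)
      have hh : Function.Injective h := by
        refine Function.Injective.sumElim Subtype.val_injective
          (Subtype.val_injective.comp hg) ?_
        rintro ⟨a, ha⟩ b rfl
        exact ha (g b).2
      let W' : Finset V := W \ univ.image (i₂ ∘ g)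
      have hWh : ∀ v, v ∉ W' ↔ ∃ i, h i = v := by
        intro v
        simp only [W', mem_sdiff, mem_image, mem_univ, true_and, not_and, not_not, Sum.exists, h,
          Sum.elim_inl, Sum.elim_inr]
        constructor
        · intro hv
          by_cases hvW : v ∈ W
          · exact Or.inr (hv hvW)
          · exact Or.inl ⟨⟨v, hvW⟩, rfl⟩
        · rintro (⟨⟨a, ha⟩, rfl⟩ | hb) hvW
          · exact absurd hvW ha
          · exact hb
      have hcard : W'.card < W.card := by
        refine card_lt_card ⟨sdiff_subset, fun hsub => ?_⟩
        obtain ⟨k⟩ := ‹Nonempty κ›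
        exact (mem_sdiff.1 (hsub (g k).2)).2 (mem_image_of_mem (i₂ ∘ g) (mem_univ k))
      have hz : principalMinor M W' = 0 := by
        by_contra hne
        exact absurd (hmax W' hne) (not_le.2 hcard)
      rw [← det_submatrix_eq_principalMinor M W' h hh hWh] at hz
      have hbl : M.submatrix h h = fromBlocks A (B.submatrix id g) (Bᵀ.submatrix g id)
          (D.submatrix g g) := by
        rw [← hB]
        ext (j | j) (k | k) <;> rfl
      rw [hbl, det_fromBlocks₁₁] at hz
      have := (mul_eq_zero.1 hz).resolve_left hd
      rw [← this, invOf_eq_nonsing_inv]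
      rfl
    refine matrix_eq_zero_of_principal_minors _ ?_ (fun j => ?_) (fun j k hjk => ?_)
    · rw [IsSymm, transpose_sub, transpose_mul, transpose_mul, transpose_transpose,
        transpose_nonsing_inv, hA.eq, Matrix.mul_assoc, (hM.submatrix _ : D.IsSymm).eq]
    · have := key (κ := Unit) (fun _ => j) (fun _ _ _ => rfl)
      simpa [det_unique] using this
    · have := key (κ := Fin 2) ![j, k] (by
        intro a b
        fin_cases a <;> fin_cases b <;> simp [hjk, Ne.symm hjk])
      rw [det_fin_two] at this
      exact this
  rw [sub_eq_zero] at hschur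
  have hre : ∑ y : V → ZMod 3, ψ (y ⬝ᵥ M *ᵥ y) =
      ∑ y : {v // v ∉ W} ⊕ {v // v ∈ W} → ZMod 3, ψ (y ⬝ᵥ (M.submatrix σ σ) *ᵥ y) := by
    refine (Equiv.sum_comp (Equiv.arrowCongr σ (Equiv.refl (ZMod 3))) _).symm.trans ?_
    refine sum_congr rfl fun y _ => congrArg ψ ?_
    rw [submatrix_mulVec_equiv]
    simp only [dotProduct]
    rw [← σ.sum_comp]
    simp only [Equiv.arrowCongr_apply, Function.comp_apply, Equiv.coe_refl, id,
      Equiv.symm_apply_apply]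
    rfl
  rw [hre, hblocks, hschur, sum_ψ_quadratic_fromBlocks A B hA hd]
  have c1 : Fintype.card {v // v ∈ W} = W.card := Fintype.card_coe W
  have c2 : Fintype.card {v // v ∉ W} = Fintype.card V - W.card := by
    rw [Fintype.card_subtype_compl, c1]
  rw [c1, c2]
  rfl

end GaussSum

/-! ### Connectivity tested by functions. -/

section Connectivity

variable {α β : Type*}

theorem Joined.apply_eq {γ : Type*} {H : Graph α β} {f : α → γ}
    (hf : ∀ e u v, H.IsLink e u v → f u = f v) {u v : α} (h : Joined H u v) : f u = f v := by
  induction h with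
  | refl => rfl
  | tail _ hab ih =>
    obtain ⟨e, he⟩ := hab
    exact ih.trans (hf e _ _ he)

open Classical in
theorem indicator_joined_eq (H : Graph α β) (a : α) (e : β) (u v : α) (h : H.IsLink e u v) :
    (if Joined H a u then (1 : ZMod 3) else 0) = if Joined H a v then 1 else 0 := by
  have h1 : Joined H a u ↔ Joined H a v :=
    ⟨fun k => k.tail ⟨e, h⟩, fun k => k.tail ⟨e, h.symm⟩⟩
  simp [h1]

/-- The indicator of the set reachable from `u` is constant along edges and would separate `u` from
an unreachable `v`. This makes connectivity a statement of linear algebra. -/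
theorem isConnected_of_forall_eq {H : Graph α β} (hne : V(H).Nonempty)
    (h : ∀ f : α → ZMod 3, (∀ e u v, H.IsLink e u v → f u = f v) →
      ∀ u ∈ V(H), ∀ v ∈ V(H), f u = f v) : IsConnected H := by
  classical
  refine ⟨hne, fun u hu v hv => ?_⟩
  have := h (fun w => if Joined H u w then 1 else 0)
    (fun e a b => indicator_joined_eq H u e a b) u hu v hv
  by_contra hn
  simp [hn, show Joined H u u from Relation.ReflTransGen.refl] at this

end Connectivity

/-! ### Signed incidence matrix. -/

section Incidence

variable {V : Type*}

/-- The difference of the values of `y` at the ends of `e`, for a fixed orientation of `e`. -/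
noncomputable def endDiff (e : Sym2 V) : (V → ZMod 3) →ₗ[ZMod 3] ZMod 3 where
  toFun y := y (Quot.out e).1 - y (Quot.out e).2
  map_add' y z := by simp only [Pi.add_apply]; ring
  map_smul' c y := by simp only [Pi.smul_apply, smul_eq_mul, RingHom.id_apply]; ring

theorem endDiff_apply (e : Sym2 V) (y : V → ZMod 3) :
    endDiff e y = y (Quot.out e).1 - y (Quot.out e).2 := rfl

theorem endDiff_mk (u v : V) : (∀ y, endDiff s(u, v) y = y u - y v) ∨
    ∀ y, endDiff s(u, v) y = y v - y u := by
  have h : s((Quot.out s(u, v)).1, (Quot.out s(u, v)).2) = s(u, v) := Quot.out_eq s(u, v)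
  rw [Sym2.eq_iff] at h
  rcases h with ⟨h1, h2⟩ | ⟨h1, h2⟩
  · left
    intro y
    rw [endDiff_apply, h1, h2]
  · right
    intro y
    rw [endDiff_apply, h1, h2]

theorem endDiff_mk_eq_zero {u v : V} {y : V → ZMod 3} : endDiff s(u, v) y = 0 ↔ y u = y v := by
  rcases endDiff_mk u v with h | h <;> rw [h] <;> simp [sub_eq_zero, eq_comm]

theorem endDiff_mk_sq (u v : V) (y : V → ZMod 3) : endDiff s(u, v) y ^ 2 = (y u - y v) ^ 2 := by
  rcases endDiff_mk u v with h | h <;> rw [h]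
  ring

variable [Fintype V] [DecidableEq V]

/-- The signed incidence matrix of the complete graph. -/
noncomputable def signedIncidence (V : Type*) [DecidableEq V] : Matrix V (Sym2 V) (ZMod 3) :=
  Matrix.of fun v e => endDiff e (Pi.single v 1)

theorem sum_mul_signedIncidence (y : V → ZMod 3) (e : Sym2 V) :
    ∑ v, y v * signedIncidence V v e = endDiff e y := by
  conv_rhs => rw [pi_eq_sum_univ' y, map_sum]
  refine sum_congr rfl fun v _ => ?_
  rw [map_smul, smul_eq_mul]
  rfl

end Incidence

/-! ### Matrix-tree theorem for contractions. -/

section MatrixTree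

variable {V : Type*} [Fintype V] [DecidableEq V] (G : SimpleGraph V)

/-- The part of the incidence matrix that belongs to the vertices outside `W`. -/
noncomputable def reducedIncidence (W : Finset V) : Matrix {v // v ∉ W} (Sym2 V) (ZMod 3) :=
  (signedIncidence V).submatrix Subtype.val id

/-- Extension by zero of a function on the complement of `W`. -/
def zeroExtend (W : Finset V) (y : {v // v ∉ W} → ZMod 3) (v : V) : ZMod 3 :=
  if h : v ∉ W then y ⟨v, h⟩ else 0

theorem zeroExtend_of_mem {W : Finset V} (y : {v // v ∉ W} → ZMod 3) {v : V} (h : v ∈ W) :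
    zeroExtend W y v = 0 := by simp [zeroExtend, h]

theorem zeroExtend_restrict {W : Finset V} (g : V → ZMod 3) (hg : ∀ v ∈ W, g v = 0) :
    zeroExtend W (fun v => g v) = g := by
  ext v
  by_cases h : v ∈ W <;> simp [zeroExtend, h, hg]

/-- Vectors on the complement of `W` are functions on G/W normalized to vanish at the merged vertex;
the column map is their coboundary on `T`. -/
theorem columnMap_reducedIncidence (W : Finset V) (T : Finset (Sym2 V))
    (y : {v // v ∉ W} → ZMod 3) (e : T) :
    columnMap (reducedIncidence W) T y e = endDiff (e : Sym2 V) (zeroExtend W y) := by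
  rw [columnMap_apply, ← sum_mul_signedIncidence,
    ← Fintype.sum_subtype_add_sum_subtype (fun v => v ∉ W)]
  rw [Finset.sum_eq_zero (s := (univ : Finset {v // ¬ v ∉ W}))]
  · rw [add_zero]
    refine sum_congr rfl fun v _ => ?_
    simp [zeroExtend, v.2, reducedIncidence]
  · rintro ⟨v, hv⟩ _
    rw [zeroExtend_of_mem y (not_not.1 hv), zero_mul]

/-- The class of a vertex in the contraction of `W`. -/
def contractMk (W : Finset V) (v : V) : Quotient (contractSetoid W) := Quotient.mk _ v

theorem contractMk_eq_iff {W : Finset V} {u v : V} :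
    contractMk W u = contractMk W v ↔ u = v ∨ (u ∈ W ∧ v ∈ W) :=
  Quotient.eq (r := contractSetoid W)

variable {G}

theorem vertexSet_contract (W : Finset V) : V(contract G W) = Set.univ := by
  exact Set.image_univ_of_surjective (Quotient.mk_surjective (s := contractSetoid W))

theorem isLink_contract_restrict {W : Finset V} {T : Finset (Sym2 V)} {e : Sym2 V}
    {a b : Quotient (contractSetoid W)} :
    ((contract G W).restrict T).IsLink e a b ↔
      e ∈ T ∧ ∃ u v, G.Adj u v ∧ e = s(u, v) ∧ contractMk W u = a ∧ contractMk W v = b := by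
  rw [Graph.restrict_isLink]
  simp only [contract, Graph.map_isLink, Relation.map_apply, mem_coe, contractMk]
  constructor
  · rintro ⟨h, u, v, huv, ha, hb⟩
    refine ⟨by assumption, u, v, ?_⟩
    obtain ⟨he, hG⟩ := huv
    subst he
    exact ⟨hG, rfl, ha, hb⟩
  · rintro ⟨h, u, v, huv, he, ha, hb⟩
    refine ⟨by assumption, u, v, ?_, ha, hb⟩
    subst he
    exact ⟨rfl, huv⟩

/-- Injectivity of the coboundary means connectedness, surjectivity means acyclicity. Nonemptiness
of `W` provides the vertex at which functions are normalized. -/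
theorem isSpanningTree_contract_iff {W : Finset V} (hW : W.Nonempty) {T : Finset (Sym2 V)}
    (hT : (T : Set (Sym2 V)) ⊆ G.edgeSet) :
    IsSpanningTree (contract G W) T ↔ Function.Bijective (columnMap (reducedIncidence W) T) := by
  classical
  obtain ⟨w, hw⟩ := hW
  have hlift (y : {v // v ∉ W} → ZMod 3) : ∃ f : Quotient (contractSetoid W) → ZMod 3,
      ∀ v, f (contractMk W v) = zeroExtend W y v := by
    refine ⟨Quotient.lift (zeroExtend W y) ?_, fun v => rfl⟩
    rintro u v (rfl | ⟨hu, hv⟩)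
    · rfl
    · rw [zeroExtend_of_mem _ hu, zeroExtend_of_mem _ hv]
  -- Subtracting the value at the merged vertex leaves all differences unchanged.
  have hdrop (f : Quotient (contractSetoid W) → ZMod 3) :
      zeroExtend W (fun v => f (contractMk W v) - f (contractMk W w)) =
        fun v => f (contractMk W v) - f (contractMk W w) := by
    refine zeroExtend_restrict (fun v => f (contractMk W v) - f (contractMk W w)) fun v hv => ?_
    rw [contractMk_eq_iff.2 (Or.inr ⟨hv, hw⟩), sub_self]
  have hmk : ∀ a : Quotient (contractSetoid W), ∃ v, contractMk W v = a := Quotient.mk_surjective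
  have hmem (a) : a ∈ V(contract G W) := vertexSet_contract (G := G) W ▸ Set.mem_univ a
  have hadj : ∀ e ∈ T, ∃ u v, G.Adj u v ∧ e = s(u, v) := by
    intro e he
    have := hT he
    induction e with
    | _ u v => exact ⟨u, v, this, rfl⟩
  constructor
  · rintro ⟨-, hconn, hacyc⟩
    constructor
    · rw [← LinearMap.ker_eq_bot, LinearMap.ker_eq_bot']
      intro y hy
      obtain ⟨f, hf⟩ := hlift y
      have hresp : ∀ e a b, ((contract G W).restrict T).IsLink e a b → f a = f b := by
        intro e a b h
        obtain ⟨he, u, v, huv, rfl, rfl, rfl⟩ := isLink_contract_restrict.1 h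
        have := congrFun hy ⟨_, he⟩
        rw [columnMap_reducedIncidence] at this
        rw [hf, hf]
        exact endDiff_mk_eq_zero.1 this
      ext v
      have hj := hconn.2 (contractMk W v) (hmem _) (contractMk W w)
        (hmem _)
      have := hj.apply_eq hresp
      rw [hf, hf, zeroExtend_of_mem _ hw] at this
      simpa [zeroExtend, v.2] using this
    -- Fundamental cut: after deleting `e`, the indicator of the component of one end has difference
    -- ±1 on `e` and 0 on the other edges of `T`.
    · have hsingle (e : T) : Pi.single e 1 ∈ LinearMap.range (columnMap (reducedIncidence W) T) := by
        obtain ⟨u, v, huv, he⟩ := hadj e e.2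
        have hlink : ((contract G W).restrict T).IsLink e (contractMk W u) (contractMk W v) :=
          isLink_contract_restrict.2 ⟨e.2, u, v, huv, he, rfl, rfl⟩
        have hn := hacyc _ _ _ hlink
        set H := (((contract G W).restrict T).deleteEdges {(e : Sym2 V)}) with hH
        let f : Quotient (contractSetoid W) → ZMod 3 :=
          fun a => if Joined H (contractMk W u) a then 1 else 0
        let y : {v // v ∉ W} → ZMod 3 := fun v => f (contractMk W v) - f (contractMk W w)
        have hy : zeroExtend W y = fun v => f (contractMk W v) - f (contractMk W w) := hdrop f
        have hval : endDiff (e : Sym2 V) (zeroExtend W y) = 1 ∨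
            endDiff (e : Sym2 V) (zeroExtend W y) = -1 := by
          have hfu : f (contractMk W u) = 1 := if_pos Relation.ReflTransGen.refl
          have hfv : f (contractMk W v) = 0 := if_neg hn
          rw [he, hy]
          rcases endDiff_mk u v with h | h <;> rw [h, hfu, hfv]
          · left; ring
          · right; ring
        have hcol : columnMap (reducedIncidence W) T y =
            endDiff (e : Sym2 V) (zeroExtend W y) • Pi.single e 1 := by
          ext e'
          rw [columnMap_reducedIncidence]
          by_cases hee : e' = e
          · rw [hee]
            simp
          · obtain ⟨u', v', huv', he'⟩ := hadj e' e'.2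
            have hlink' : H.IsLink e' (contractMk W u') (contractMk W v') := by
              rw [hH, Graph.deleteEdges_isLink]
              refine ⟨isLink_contract_restrict.2 ⟨e'.2, u', v', huv', he', rfl, rfl⟩, ?_⟩
              exact fun h => hee (Subtype.ext h)
            have := indicator_joined_eq H (contractMk W u) _ _ _ hlink'
            have h0 : endDiff (e' : Sym2 V) (zeroExtend W y) = 0 := by
              rw [he', endDiff_mk_eq_zero, hy]
              simp only [f, this]
            rw [h0]
            simp [hee]
        rcases hval with h | h
        · exact ⟨y, by rw [hcol, h, one_smul]⟩
        · exact ⟨-y, by rw [map_neg, hcol, h, neg_smul, neg_neg, one_smul]⟩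
      rw [← LinearMap.range_eq_top, eq_top_iff]
      intro z _
      rw [pi_eq_sum_univ' z]
      exact Submodule.sum_mem _ fun e _ => Submodule.smul_mem _ _ (hsingle e)
  · rintro ⟨hinj, hsurj⟩
    refine ⟨hT, isConnected_of_forall_eq ⟨contractMk W w, hmem _⟩ ?_, ?_⟩
    · intro f hf
      let y : {v // v ∉ W} → ZMod 3 := fun v => f (contractMk W v) - f (contractMk W w)
      have hy : zeroExtend W y = fun v => f (contractMk W v) - f (contractMk W w) := hdrop f
      have hy0 : y = 0 := by
        refine hinj ?_
        rw [map_zero]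
        ext e
        obtain ⟨u, v, huv, he⟩ := hadj e e.2
        rw [columnMap_reducedIncidence, he, Pi.zero_apply, endDiff_mk_eq_zero, hy]
        have := hf e _ _ (isLink_contract_restrict.2 ⟨e.2, u, v, huv, he, rfl, rfl⟩)
        simp only [this]
      have hconst (a : Quotient (contractSetoid W)) : f a = f (contractMk W w) := by
        obtain ⟨v, rfl⟩ := hmk a
        have h1 := congrFun hy v
        rw [hy0] at h1
        have h2 : zeroExtend W (0 : {v // v ∉ W} → ZMod 3) v = 0 := by simp [zeroExtend]
        rw [h2] at h1
        exact (sub_eq_zero.1 h1.symm)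
      intro a _ b _
      rw [hconst a, hconst b]
    · intro e a b hlink hj
      obtain ⟨heT, u, v, huv, he, rfl, rfl⟩ := isLink_contract_restrict.1 hlink
      -- A function whose only nonzero difference is at `e` would be constant along a walk that
      -- joins the ends of `e` and avoids `e`.
      obtain ⟨y, hy⟩ := hsurj (Pi.single ⟨e, heT⟩ 1)
      obtain ⟨f, hf⟩ := hlift y
      have hcol (e' : T) : endDiff (e' : Sym2 V) (zeroExtend W y) =
          (Pi.single ⟨e, heT⟩ 1 : T → ZMod 3) e' := by
        rw [← columnMap_reducedIncidence, hy]
      have hfe : f (contractMk W u) = f (contractMk W v) := by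
        refine hj.apply_eq ?_
        intro e' a' b' hl
        rw [Graph.deleteEdges_isLink] at hl
        obtain ⟨he'T, u', v', huv', he', rfl, rfl⟩ := isLink_contract_restrict.1 hl.1
        rw [hf, hf, ← endDiff_mk_eq_zero, ← he', hcol ⟨e', he'T⟩]
        have : (⟨e', he'T⟩ : T) ≠ ⟨e, heT⟩ := fun h => hl.2 (congrArg Subtype.val h)
        simp [this]
      rw [hf, hf, ← endDiff_mk_eq_zero, ← he, hcol ⟨e, heT⟩] at hfe
      simp at hfe

open Classical in
/-- The weights of the edges of `G`, and `0` outside. -/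
noncomputable def restrictWeight (G : SimpleGraph V) (x : Sym2 V → ZMod 3) (e : Sym2 V) : ZMod 3 :=
  if e ∈ G.edgeSet then x e else 0

/-- The weighted Laplacian. -/
noncomputable def laplacian (G : SimpleGraph V) (x : Sym2 V → ZMod 3) : Matrix V V (ZMod 3) :=
  signedIncidence V * diagonal (restrictWeight G x) * (signedIncidence V)ᵀ

theorem laplacian_isSymm (x : Sym2 V → ZMod 3) : (laplacian G x).IsSymm := by
  rw [IsSymm, laplacian, transpose_mul, transpose_mul, transpose_transpose, diagonal_transpose,
    Matrix.mul_assoc]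

theorem dotProduct_laplacian_mulVec (x : Sym2 V → ZMod 3) (y : V → ZMod 3) :
    y ⬝ᵥ laplacian G x *ᵥ y = ∑ e, restrictWeight G x e * endDiff e y ^ 2 := by
  have h : (signedIncidence V)ᵀ *ᵥ y = fun e => endDiff e y := by
    ext e
    rw [← sum_mul_signedIncidence, mulVec_transpose]
    rfl
  have h' : y ᵥ* signedIncidence V = fun e => endDiff e y := by
    rw [← h, mulVec_transpose]
  rw [laplacian, ← mulVec_mulVec, ← mulVec_mulVec, h, dotProduct_mulVec, h']
  simp only [dotProduct, mulVec_diagonal]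
  exact sum_congr rfl fun e _ => by ring

/-- The weighted matrix-tree theorem for contractions. -/
theorem treeSum_contract {W : Finset V} (hW : W.Nonempty) (x : Sym2 V → ZMod 3) :
    treeSum (contract G W) x = principalMinor (laplacian G x) W := by
  classical
  have h : (laplacian G x).submatrix (Subtype.val : {v // v ∉ W} → V) Subtype.val =
      reducedIncidence W * diagonal (restrictWeight G x) * (reducedIncidence W)ᵀ := by
    ext i j
    simp [laplacian, reducedIncidence, Matrix.mul_apply]
  rw [principalMinor, h, det_mul_diagonal_mul_transpose, treeSum, sum_filter, sum_filter]
  refine sum_congr (by congr!) fun T _ => ?_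
  by_cases hT : (T : Set (Sym2 V)) ⊆ G.edgeSet
  · rw [if_congr (isSpanningTree_contract_iff hW hT)]
    · exact prod_congr rfl fun e he => (if_pos (hT he)).symm
    · rfl
  -- The incidence matrix has a column for every unordered pair; those outside `G` carry weight 0.
  · obtain ⟨e, he, heG⟩ := Set.not_subset.1 hT
    rw [if_neg fun h => hT h.1, prod_eq_zero he (if_neg heG), ite_self]

/-! ### Minimal contractions and maximal principal minors. -/

theorem principalMinor_laplacian_empty [Nonempty V] (x : Sym2 V → ZMod 3) :
    principalMinor (laplacian G x) ∅ = 0 := by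
  let e : V ≃ {v : V // v ∉ (∅ : Finset V)} := (Equiv.subtypeUnivEquiv (by simp)).symm
  rw [principalMinor, ← det_submatrix_equiv_self e]
  change (laplacian G x).det = 0
  rw [← exists_mulVec_eq_zero_iff]
  refine ⟨fun _ => 1, fun h => one_ne_zero (congrFun h (Classical.arbitrary V)), ?_⟩
  have : (signedIncidence V)ᵀ *ᵥ (fun _ => 1) = 0 := by
    ext e
    rw [mulVec_transpose]
    refine (sum_mul_signedIncidence (fun _ => 1) e).trans ?_
    simp [endDiff_apply]
  rw [laplacian, ← mulVec_mulVec, this, mulVec_zero]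

/-- A minimal contraction may be empty, although deleting nothing from the singular Laplacian leaves
minor 0. Since G/∅ = G/{v}, such a choice can be replaced by a singleton. -/
theorem contractSetoid_empty (v : V) : contractSetoid (∅ : Finset V) = contractSetoid {v} := by
  ext a b
  change (a = b ∨ _) ↔ (a = b ∨ _)
  simp only [notMem_empty, mem_singleton]
  grind

theorem treeSum_contract_empty (v : V) (x : Sym2 V → ZMod 3) :
    treeSum (contract G ∅) x = treeSum (contract G {v}) x := by
  unfold contract
  rw [contractSetoid_empty v]

theorem contractOrder_empty (v : V) : contractOrder G ∅ = contractOrder G {v} := by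
  unfold contractOrder contract
  rw [contractSetoid_empty v]

theorem contractOrder_of_nonempty {W : Finset V} (hW : W.Nonempty) :
    contractOrder G W = Fintype.card V - W.card + 1 := by
  classical
  obtain ⟨w, hw⟩ := hW
  rw [contractOrder, vertexSet_contract, Set.ncard_univ]
  have : Function.Bijective (fun o : Option {v // v ∉ W} =>
      o.elim (contractMk W w) (fun v => contractMk W v)) := by
    constructor
    · rintro (_ | ⟨a, ha⟩) (_ | ⟨b, hb⟩) h
      · rfl
      · rcases contractMk_eq_iff.1 h with h | h
        · exact absurd (by rwa [h] at hw) hb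
        · exact absurd h.2 hb
      · rcases contractMk_eq_iff.1 h with h | h
        · exact absurd (by rwa [← h] at hw) ha
        · exact absurd h.1 ha
      · rcases contractMk_eq_iff.1 h with h | h
        · exact congrArg some (Subtype.ext h)
        · exact absurd h.1 ha
    · intro a
      obtain ⟨v, rfl⟩ : ∃ v, contractMk W v = a := Quotient.mk_surjective a
      by_cases hv : v ∈ W
      · exact ⟨none, contractMk_eq_iff.2 (Or.inr ⟨hw, hv⟩)⟩
      · exact ⟨some ⟨v, hv⟩, rfl⟩
  rw [← Nat.card_congr (Equiv.ofBijective _ this), Nat.card_eq_fintype_card, Fintype.card_option,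
    Fintype.card_subtype_compl, Fintype.card_coe]

/-- Every minimal contraction comes from a nonempty one, with a maximal nonzero minor. -/
theorem IsMinContraction.exists_nonempty [Nonempty V] {x : Sym2 V → ZMod 3} {W : Finset V}
    (h : IsMinContraction G x W) :
    ∃ W₁ : Finset V, W₁.Nonempty ∧ treeSum (contract G W) x = principalMinor (laplacian G x) W₁ ∧
      contractOrder G W = contractOrder G W₁ ∧
      ∀ W', principalMinor (laplacian G x) W' ≠ 0 → W₁.card ≤ W'.card := by
  have hne (W') (h' : principalMinor (laplacian G x) W' ≠ 0) : W'.Nonempty := by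
    rw [nonempty_iff_ne_empty]
    rintro rfl
    exact h' (principalMinor_laplacian_empty x)
  rcases W.eq_empty_or_nonempty with rfl | hW
  · let v := Classical.arbitrary V
    refine ⟨{v}, singleton_nonempty v, ?_, contractOrder_empty v, fun W' h' => ?_⟩
    · rw [treeSum_contract_empty v, treeSum_contract (singleton_nonempty v)]
    · rw [card_singleton]
      exact (hne W' h').card_pos
  · refine ⟨W, hW, treeSum_contract hW x, rfl, fun W' h' => h.2 W' ?_⟩
    rwa [treeSum_contract (hne W' h')]

theorem exists_isMinContraction [Nonempty V] (x : Sym2 V → ZMod 3) :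
    ∃ W : Finset V, IsMinContraction G x W := by
  -- Merging all vertices leaves the empty determinant, which is 1.
  have hu : treeSum (contract G univ) x ≠ 0 := by
    rw [treeSum_contract univ_nonempty, principalMinor]
    have : IsEmpty {v : V // v ∉ (univ : Finset V)} := ⟨fun v => v.2 (mem_univ _)⟩
    rw [det_isEmpty]
    exact one_ne_zero
  classical
  obtain ⟨W, hW, hmin⟩ := exists_min_image
    (univ.filter fun W : Finset V => treeSum (contract G W) x ≠ 0) card ⟨univ, by simpa using hu⟩
  exact ⟨W, (mem_filter.1 hW).2, fun W' h' => hmin W' (by simpa using h')⟩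

/-- From (-i√3)(i√3) = 3; this matches the chosen root of -3 in the weight with the value i√3 of the
Gauss sum. -/
theorem inv_pow_sqrt (r : ℕ) : ((-Complex.I * (Real.sqrt 3 : ℂ)) ^ r)⁻¹ =
    (Complex.I * (Real.sqrt 3 : ℂ)) ^ r / 3 ^ r := by
  rw [← inv_pow, ← div_pow]
  congr 1
  have h : (Real.sqrt 3 : ℂ) ≠ 0 := by
    simp
  rw [inv_eq_iff_eq_inv, inv_div, eq_div_iff (by simp)]
  linear_combination (-(Real.sqrt 3 : ℂ) ^ 2) * Complex.I_sq + sqrt_three_sq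

/-- The weight is a normalized quadratic Gauss sum of the Laplacian. -/
theorem IsMinContraction.weight_eq [Nonempty V] {x : Sym2 V → ZMod 3} {W : Finset V}
    (h : IsMinContraction G x W) :
    weight G x W = (∑ y : V → ZMod 3, ψ (y ⬝ᵥ laplacian G x *ᵥ y)) / 3 ^ Fintype.card V := by
  obtain ⟨W₁, hne, htree, hord, hmax⟩ := h.exists_nonempty
  have h0 := h.1
  rw [htree] at h0
  have hle : W₁.card ≤ Fintype.card V := card_le_univ W₁
  rw [weight, hord, contractOrder_of_nonempty hne, htree,
    sum_ψ_quadratic _ (laplacian_isSymm x) W₁ h0 hmax, Nat.add_sub_cancel, div_eq_mul_inv,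
    inv_pow_sqrt]
  have : (3 : ℂ) ^ Fintype.card V = 3 ^ W₁.card * 3 ^ (Fintype.card V - W₁.card) := by
    rw [← pow_add, Nat.add_sub_cancel' hle]
  rw [this]
  field_simp

theorem IsMinContraction.contractOrder_eq [Nonempty V] {x : Sym2 V → ZMod 3} {W W' : Finset V}
    (h : IsMinContraction G x W) (h' : IsMinContraction G x W') :
    contractOrder G W = contractOrder G W' := by
  obtain ⟨W₁, hne, htree, hord, hmax⟩ := h.exists_nonempty
  obtain ⟨W₂, hne', htree', hord', hmax'⟩ := h'.exists_nonempty
  have h0 := h.1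
  have h0' := h'.1
  rw [htree] at h0
  rw [htree'] at h0'
  rw [hord, hord', contractOrder_of_nonempty hne, contractOrder_of_nonempty hne',
    le_antisymm (hmax _ h0') (hmax' _ h0)]

end MatrixTree

/-! ### Darts and faces of a rotation system. -/

theorem apply_eq_of_sameCycle {α γ : Type*} [Finite α] {σ : Equiv.Perm α} {f : α → γ}
    (hf : ∀ a, f (σ a) = f a) {a b : α} (h : σ.SameCycle a b) : f a = f b := by
  obtain ⟨n, -, rfl⟩ := h.exists_pow_eq'
  induction n with
  | zero => rfl
  | succ n ih => rw [pow_succ', Equiv.Perm.mul_apply, hf, ih ⟨n, by simp⟩]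

theorem finrank_le_one_of_forall_eq_smul {ι K : Type*} [Finite ι] [Field K]
    (S : Submodule K (ι → K)) (u : ι → K) (h : ∀ w ∈ S, ∃ c : K, c • u = w) :
    Module.finrank K S ≤ 1 := by
  have hle : S ≤ Submodule.span K {u} := fun w hw => Submodule.mem_span_singleton.2 (h w hw)
  exact (Submodule.finrank_mono hle).trans ((finrank_span_le_card {u}).trans (by simp))

namespace RotationSystem

variable {V : Type*} [Fintype V] {G : SimpleGraph V} (R : RotationSystem G)

theorem fst_rot (d : G.Dart) : (R.rot d).fst = d.fst :=
  ((R.sameCycle_rot_iff d (R.rot d)).1 ⟨1, rfl⟩).symm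

theorem faceNext_symm (d : G.Dart) : R.faceNext d.symm = R.rot d := by
  change R.rot d.symm.symm = R.rot d
  rw [SimpleGraph.Dart.symm_symm]

theorem fst_faceNext (d : G.Dart) : (R.faceNext d).fst = d.snd := R.fst_rot d.symm

theorem face_eq_iff {d d' : G.Dart} : R.face d = R.face d' ↔ R.faceNext.SameCycle d d' :=
  Quotient.eq (r := Equiv.Perm.SameCycle.setoid R.faceNext)

theorem face_faceNext (d : G.Dart) : R.face (R.faceNext d) = R.face d :=
  R.face_eq_iff.2 ⟨-1, by simp⟩

theorem face_symm (d : G.Dart) : R.face d.symm = R.face (R.rot d) := by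
  rw [← faceNext_symm, face_faceNext]

theorem face_surjective : Function.Surjective R.face := Quotient.mk_surjective

theorem eq_of_preconnected {γ : Type*} (hG : G.Preconnected) {p : V → γ}
    (hp : ∀ d : G.Dart, p d.fst = p d.snd) (u v : V) : p u = p v := by
  obtain ⟨w⟩ := hG u v
  induction w with
  | nil => rfl
  | cons h _ ih => exact (hp ⟨(_, _), h⟩).trans ih

/-- Rotation reaches every dart at a vertex and reversal crosses an edge, so together they act
transitively on the darts of a connected graph. -/
theorem eq_of_rot_of_symm {γ : Type*} (hG : G.Preconnected) {f : G.Dart → γ}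
    (hr : ∀ d, f (R.rot d) = f d) (hs : ∀ d, f d.symm = f d) (d d' : G.Dart) : f d = f d' := by
  have hv (d d' : G.Dart) (h : d.fst = d'.fst) : f d = f d' :=
    apply_eq_of_sameCycle hr ((R.sameCycle_rot_iff d d').2 h)
  have key : ∀ (u v : V) (_ : G.Walk u v) (d d' : G.Dart), d.fst = u → d'.fst = v → f d = f d' := by
    intro u v w
    induction w with
    | nil => exact fun d d' h h' => hv d d' (h.trans h'.symm)
    | cons h _ ih =>
      intro d d' hd hd'
      rw [hv d ⟨(_, _), h⟩ hd, ← hs]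
      exact ih _ d' rfl hd'
  obtain ⟨w⟩ := hG d.fst d'.fst
  exact key _ _ w d d' rfl rfl

section Triangle

variable (hF : ∀ F : R.Face, {d : G.Dart | R.face d = F}.ncard = 3)
include hF

open Classical in
theorem card_filter_face (F : R.Face) : #{d : G.Dart | R.face d = F} = 3 := by
  rw [← hF F, ← Set.ncard_coe_finset]
  congr 1
  ext d
  simp

open Classical in
theorem isCycleOn_faceNext (F : R.Face) :
    R.faceNext.IsCycleOn (({d : G.Dart | R.face d = F} : Finset G.Dart) : Set G.Dart) := by
  refine ⟨⟨fun d hd => ?_, R.faceNext.injective.injOn, fun d hd => ?_⟩, fun d hd d' hd' => ?_⟩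
  · simpa [face_faceNext] using hd
  · refine ⟨R.faceNext.symm d, ?_, by simp⟩
    have := R.face_faceNext (R.faceNext.symm d)
    rw [Equiv.apply_symm_apply] at this
    simpa [← this] using hd
  · have h1 : R.face d = F := by simpa using hd
    have h2 : R.face d' = F := by simpa using hd'
    exact R.face_eq_iff.1 (h1.trans h2.symm)

theorem faceNext_cubed (d : G.Dart) : R.faceNext (R.faceNext (R.faceNext d)) = d := by
  classical
  have := (R.isCycleOn_faceNext hF (R.face d)).pow_card_apply (a := d) (by simp)
  rw [R.card_filter_face hF] at this
  exact this

theorem eq_of_face_eq {d d' : G.Dart} (h : R.face d' = R.face d) :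
    d' = d ∨ d' = R.faceNext d ∨ d' = R.faceNext (R.faceNext d) := by
  classical
  obtain ⟨n, hn, rfl⟩ := (R.isCycleOn_faceNext hF (R.face d)).exists_pow_eq (a := d) (b := d')
    (by simp) (by simpa using h)
  rw [R.card_filter_face hF] at hn
  interval_cases n
  · exact Or.inl rfl
  · exact Or.inr (Or.inl rfl)
  · exact Or.inr (Or.inr rfl)

theorem snd_faceNext_faceNext (d : G.Dart) : (R.faceNext (R.faceNext d)).snd = d.fst := by
  rw [← fst_faceNext, R.faceNext_cubed hF]

/-- The darts of a face form a closed walk of length three; if two consecutive ones had the same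
edge, one of the darts would be a loop. -/
theorem edge_faceNext_ne (d : G.Dart) : (R.faceNext d).edge ≠ d.edge := by
  have h1 := R.fst_faceNext d
  have h2 := R.fst_faceNext (R.faceNext d)
  have h3 := R.snd_faceNext_faceNext hF d
  have h4 := (R.faceNext (R.faceNext d)).adj.ne
  have h5 := d.adj.ne
  rw [Ne, SimpleGraph.dart_edge_eq_iff]
  rintro (h | h)
  · rw [h] at h1
    exact h5 h1
  · have h6 : (R.faceNext d).snd = d.fst := by rw [h]; rfl
    exact h4 (h2.trans (h6.trans h3.symm))

theorem edge_faceNext_faceNext_ne (d : G.Dart) : (R.faceNext (R.faceNext d)).edge ≠ d.edge := by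
  have := R.edge_faceNext_ne hF (R.faceNext (R.faceNext d))
  rw [R.faceNext_cubed hF] at this
  exact this.symm

open Classical in
theorem sum_face {K : Type*} [AddCommMonoid K] (g : G.Dart → K) (d : G.Dart) :
    ∑ d' : G.Dart with R.face d' = R.face d, g d' =
      g d + (g (R.faceNext d) + g (R.faceNext (R.faceNext d))) := by
  have h1 : d ≠ R.faceNext d := fun h => R.edge_faceNext_ne hF d (congrArg _ h.symm)
  have h2 : d ≠ R.faceNext (R.faceNext d) :=
    fun h => R.edge_faceNext_faceNext_ne hF d (congrArg _ h.symm)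
  have h3 : R.faceNext d ≠ R.faceNext (R.faceNext d) := fun h => h1 (R.faceNext.injective h)
  have : ({d' : G.Dart | R.face d' = R.face d} : Finset G.Dart) =
      {d, R.faceNext d, R.faceNext (R.faceNext d)} := by
    ext d'
    simp only [mem_filter, mem_univ, true_and, mem_insert, mem_singleton]
    refine ⟨R.eq_of_face_eq hF, ?_⟩
    rintro (rfl | rfl | rfl) <;> simp only [face_faceNext]
  rw [this, sum_insert (by simp [h1, h2]), sum_insert (by simp [h3]), sum_singleton]

end Triangle

/-! ### Heawood vectors and color differences. -/

open Classical in
/-- At every vertex the values on the surrounding faces sum to zero. -/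
def IsHeawood (α : R.Face → ZMod 3) : Prop :=
  ∀ v, ∑ d : G.Dart with d.fst = v, α (R.face d) = 0

open Classical in
theorem sum_fst_rot {K : Type*} [AddCommMonoid K] (g : G.Dart → K) (v : V) :
    ∑ d : G.Dart with d.fst = v, g (R.rot d) = ∑ d : G.Dart with d.fst = v, g d := by
  rw [sum_filter, sum_filter, ← Equiv.sum_comp R.rot (fun d => if d.fst = v then g d else 0)]
  simp only [fst_rot]

/-- The color of an edge, read off from a dart. -/
def dartColor (c : G.edgeSet → ZMod 3) (d : G.Dart) : ZMod 3 := c ⟨d.edge, d.edge_mem⟩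

theorem dartColor_symm (c : G.edgeSet → ZMod 3) (d : G.Dart) :
    dartColor c d.symm = dartColor c d := by
  simp [dartColor]

theorem dartColor_surj (e : G.edgeSet) : ∃ d : G.Dart, (⟨d.edge, d.edge_mem⟩ : G.edgeSet) = e := by
  obtain ⟨e, he⟩ := e
  induction e with
  | _ u v => exact ⟨⟨(u, v), he⟩, rfl⟩

/-- Consecutive edges along a face differ by the value of `α` at this face. -/
def HasDifferences (c : G.edgeSet → ZMod 3) (α : R.Face → ZMod 3) : Prop :=
  ∀ d, dartColor c (R.faceNext d) - dartColor c d = α (R.face d)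

/-- The face step from `d.symm` is the rotation step from `d`, so the same differences can be read
around faces or around vertices. -/
theorem hasDifferences_iff_rot {c : G.edgeSet → ZMod 3} {α : R.Face → ZMod 3} :
    R.HasDifferences c α ↔ ∀ d, dartColor c (R.rot d) - dartColor c d = α (R.face d.symm) := by
  constructor
  · intro h d
    rw [← h, faceNext_symm, dartColor_symm]
  · intro h d
    rw [← dartColor_symm c d, ← SimpleGraph.Dart.symm_symm d, ← h, faceNext_symm]
    simp

/-- Around a vertex the differences telescope. -/
theorem HasDifferences.isHeawood {c : G.edgeSet → ZMod 3} {α : R.Face → ZMod 3}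
    (h : R.HasDifferences c α) : R.IsHeawood α := by
  classical
  intro v
  rw [← R.sum_fst_rot]
  simp_rw [← face_symm, ← R.hasDifferences_iff_rot.1 h]
  rw [sum_sub_distrib, R.sum_fst_rot, sub_self]

theorem HasDifferences.exists_eq_add (hG : G.Preconnected) {c c' : G.edgeSet → ZMod 3}
    {α : R.Face → ZMod 3} (h : R.HasDifferences c α) (h' : R.HasDifferences c' α)
    (e e₀ : G.edgeSet) : c e - c' e = c e₀ - c' e₀ := by
  obtain ⟨d, rfl⟩ := dartColor_surj e
  obtain ⟨d₀, rfl⟩ := dartColor_surj e₀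
  refine R.eq_of_rot_of_symm hG (f := fun d => dartColor c d - dartColor c' d) (fun d => ?_)
    (fun d => ?_) d d₀
  · have h1 := R.hasDifferences_iff_rot.1 h d
    have h2 := R.hasDifferences_iff_rot.1 h' d
    linear_combination h1 - h2
  · simp only [dartColor_symm]

/-! ### Cohomology of the medial graph: its vertices are the edges of G, its edges the darts
(corners from `d` to `rot d`), its faces the vertices and faces of G. -/

section Cohomology

/-- The coboundary from the vertices to the edges of the medial graph. -/
def medialCoboundary : (G.edgeSet → ZMod 3) →ₗ[ZMod 3] (G.Dart → ZMod 3) where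
  toFun c d := dartColor c (R.rot d) - dartColor c d
  map_add' c c' := by
    ext d
    simp only [dartColor, Pi.add_apply]
    ring
  map_smul' a c := by
    ext d
    simp only [dartColor, Pi.smul_apply, smul_eq_mul, RingHom.id_apply]
    ring

open Classical in
/-- The incidences of the edges of the medial graph with its faces. -/
noncomputable def medialFaceMatrix : Matrix (V ⊕ R.Face) G.Dart (ZMod 3) :=
  Matrix.of fun i d => i.elim (fun v => if d.fst = v then 1 else 0)
    (fun F => if R.face d.symm = F then 1 else 0)

open Classical in
theorem medialFaceMatrix_mulVec_inl (g : G.Dart → ZMod 3) (v : V) :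
    (R.medialFaceMatrix *ᵥ g) (Sum.inl v) = ∑ d : G.Dart with d.fst = v, g d := by
  simp [medialFaceMatrix, mulVec, dotProduct, sum_filter]

open Classical in
theorem medialFaceMatrix_mulVec_inr (g : G.Dart → ZMod 3) (F : R.Face) :
    (R.medialFaceMatrix *ᵥ g) (Sum.inr F) = ∑ d : G.Dart with R.face d.symm = F, g d := by
  simp [medialFaceMatrix, mulVec, dotProduct, sum_filter]

open Classical in
theorem medialFaceMatrix_transpose_mulVec (p : V ⊕ R.Face → ZMod 3) (d : G.Dart) :
    (R.medialFaceMatrixᵀ *ᵥ p) d = p (Sum.inl d.fst) + p (Sum.inr (R.face d.symm)) := by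
  simp [medialFaceMatrix, mulVec, dotProduct]

open Classical in
theorem sum_face_symm {K : Type*} [AddCommMonoid K] (g : G.Dart → K) (F : R.Face) :
    ∑ d : G.Dart with R.face d.symm = F, g d = ∑ d : G.Dart with R.face d = F, g d.symm := by
  rw [sum_filter, sum_filter, ← Equiv.sum_comp
    (SimpleGraph.Dart.symm_involutive (G := G)).toPerm]
  simp

open Classical in
theorem sum_face_faceNext {K : Type*} [AddCommMonoid K] (g : G.Dart → K) (F : R.Face) :
    ∑ d : G.Dart with R.face d = F, g (R.faceNext d) = ∑ d : G.Dart with R.face d = F, g d := by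
  rw [sum_filter, sum_filter,
    ← Equiv.sum_comp R.faceNext (fun d => if R.face d = F then g d else 0)]
  simp only [face_faceNext]

open Classical in
theorem range_medialCoboundary_le :
    LinearMap.range R.medialCoboundary ≤ LinearMap.ker R.medialFaceMatrix.mulVecLin := by
  classical
  rintro _ ⟨c, rfl⟩
  rw [LinearMap.mem_ker, mulVecLin_apply]
  ext (v | F)
  · rw [medialFaceMatrix_mulVec_inl]
    change ∑ d : G.Dart with d.fst = v, (dartColor c (R.rot d) - dartColor c d) = 0
    rw [sum_sub_distrib, R.sum_fst_rot, sub_self]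
  · rw [medialFaceMatrix_mulVec_inr, sum_face_symm]
    change ∑ d : G.Dart with R.face d = F,
      (dartColor c (R.faceNext d) - dartColor c d.symm) = 0
    simp only [dartColor_symm]
    rw [sum_sub_distrib, R.sum_face_faceNext, sub_self]

theorem finrank_ker_medialCoboundary_le (hG : G.Preconnected) :
    Module.finrank (ZMod 3) (LinearMap.ker R.medialCoboundary) ≤ 1 := by
  refine finrank_le_one_of_forall_eq_smul _ (fun _ => 1) fun c hc => ?_
  have hconst (d d' : G.Dart) : dartColor c d = dartColor c d' :=
    R.eq_of_rot_of_symm hG (fun d => sub_eq_zero.1 (congrFun hc d)) (dartColor_symm c) d d'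
  rcases isEmpty_or_nonempty G.edgeSet with h | ⟨⟨e₀⟩⟩
  · exact ⟨0, Subsingleton.elim _ _⟩
  · refine ⟨c e₀, ?_⟩
    ext e
    obtain ⟨d, rfl⟩ := dartColor_surj e
    obtain ⟨d₀, rfl⟩ := dartColor_surj e₀
    rw [Pi.smul_apply, smul_eq_mul, mul_one]
    exact hconst d₀ d

/-- A kernel vector takes opposite values at a vertex and at any incident face; moving along face
boundaries, connectedness leaves one free parameter. -/
theorem finrank_ker_medialFaceMatrix_transpose_le (hG : G.Connected) :
    Module.finrank (ZMod 3) (LinearMap.ker R.medialFaceMatrixᵀ.mulVecLin) ≤ 1 := by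
  refine finrank_le_one_of_forall_eq_smul _ (Sum.elim (fun _ => 1) fun _ => -1) fun p hp => ?_
  have hd (d : G.Dart) : p (Sum.inl d.fst) + p (Sum.inr (R.face d.symm)) = 0 := by
    rw [← medialFaceMatrix_transpose_mulVec]
    exact congrFun hp d
  have hd' (d : G.Dart) : p (Sum.inl d.snd) + p (Sum.inr (R.face d)) = 0 := by
    have := hd d.symm
    rwa [SimpleGraph.Dart.symm_symm] at this
  have hv (d : G.Dart) : p (Sum.inl d.fst) = p (Sum.inl d.snd) := by
    obtain ⟨d, rfl⟩ := R.faceNext.surjective d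
    have h1 := hd' d
    have h2 := hd' (R.faceNext d)
    rw [face_faceNext] at h2
    rw [fst_faceNext]
    linear_combination h1 - h2
  have hc := eq_of_preconnected hG.preconnected (p := fun v => p (Sum.inl v)) hv
  obtain ⟨v₀⟩ := hG.nonempty
  refine ⟨p (Sum.inl v₀), ?_⟩
  ext (v | F)
  · simpa using hc v₀ v
  · obtain ⟨d, rfl⟩ := R.face_surjective F
    have h1 := hd' d
    have h2 := hc v₀ d.snd
    simp only [Pi.smul_apply, Sum.elim_inr, smul_eq_mul]
    linear_combination -h2 - h1

open Classical in
/-- The first cohomology of the sphere vanishes. -/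
theorem ker_medialFaceMatrix_eq_range (hR : R.IsPlanar) :
    LinearMap.ker R.medialFaceMatrix.mulVecLin = LinearMap.range R.medialCoboundary := by
  classical
  refine (Submodule.eq_of_le_of_finrank_le R.range_medialCoboundary_le ?_).symm
  -- Rank count: with 2|E| darts and |V|+|F| = |E|+2, the kernel has dimension at most 2|E| -
  -- (|V|+|F|-1) = |E|-1, while the range has dimension at least |E|-1.
  have h1 := R.medialCoboundary.finrank_range_add_finrank_ker
  have h2 := R.medialFaceMatrix.mulVecLin.finrank_range_add_finrank_ker
  have h3 := R.medialFaceMatrixᵀ.mulVecLin.finrank_range_add_finrank_ker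
  have h4 : Module.finrank (ZMod 3) (LinearMap.range R.medialFaceMatrixᵀ.mulVecLin) =
      Module.finrank (ZMod 3) (LinearMap.range R.medialFaceMatrix.mulVecLin) :=
    R.medialFaceMatrix.rank_transpose
  have h5 := R.finrank_ker_medialCoboundary_le hR.1.preconnected
  have h6 := R.finrank_ker_medialFaceMatrix_transpose_le hR.1
  have h7 := hR.2
  have h8 := G.dart_card_eq_twice_card_edges
  have h9 : Nat.card G.edgeSet = #G.edgeFinset := by
    rw [Nat.card_eq_fintype_card, SimpleGraph.edgeFinset_card]
  simp only [Module.finrank_fintype_fun_eq_card, Nat.card_sum, ← Nat.card_eq_fintype_card]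
    at h1 h2 h3 h8
  omega

end Cohomology

/-! ### Tait colorings versus Heawood vectors. -/

theorem IsHeawood.exists_hasDifferences (hR : R.IsPlaneTriangulation) {α : R.Face → ZMod 3}
    (h : R.IsHeawood α) : ∃ c, R.HasDifferences c α := by
  classical
  -- Closedness around vertices is the Heawood condition; around a face it is 3α(F) = 0, as a face
  -- has three corners.
  have hmem : (fun d : G.Dart => α (R.face d.symm)) ∈
      LinearMap.ker R.medialFaceMatrix.mulVecLin := by
    rw [LinearMap.mem_ker, mulVecLin_apply]
    ext (v | F)
    · rw [medialFaceMatrix_mulVec_inl]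
      simp_rw [face_symm]
      rw [R.sum_fst_rot (fun d => α (R.face d))]
      exact h v
    · rw [medialFaceMatrix_mulVec_inr, sum_face_symm]
      simp only [SimpleGraph.Dart.symm_symm]
      rw [sum_congr rfl (g := fun _ => α F) (fun d hd => by rw [(mem_filter.1 hd).2]), sum_const,
        R.card_filter_face hR.2, nsmul_eq_mul]
      exact zero_mul _
  rw [R.ker_medialFaceMatrix_eq_range hR.1] at hmem
  obtain ⟨c, hc⟩ := hmem
  exact ⟨c, R.hasDifferences_iff_rot.2 (congrFun hc)⟩

/-- One and two steps along a face change the color by a and 2a, both nonzero mod 3. -/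
theorem HasDifferences.isTaitColoring (hR : R.IsPlaneTriangulation) {c : G.edgeSet → ZMod 3}
    {α : R.Face → (ZMod 3)ˣ} (h : R.HasDifferences c fun F => α F) : R.IsTaitColoring c := by
  intro d d' hf hne heq
  have h1 : dartColor c (R.faceNext d) - dartColor c d = (α (R.face d) : ZMod 3) := h d
  have h2 : dartColor c (R.faceNext (R.faceNext d)) - dartColor c (R.faceNext d) =
      (α (R.face d) : ZMod 3) := by
    have := h (R.faceNext d)
    rwa [face_faceNext] at this
  have h0 := (α (R.face d)).ne_zero
  have heq' : dartColor c d = dartColor c d' := heq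
  rcases R.eq_of_face_eq hR.2 hf.symm with rfl | rfl | rfl
  · exact hne rfl
  · rw [← heq', sub_self] at h1
    exact h0 h1.symm
  · rw [← heq'] at h2
    have h3 : (2 : ZMod 3) * (α (R.face d) : ZMod 3) = 0 := by linear_combination -h1 - h2
    exact h0 ((mul_eq_zero.1 h3).resolve_left (by decide))

/-- Three distinct elements of `ZMod 3` in cyclic order form an arithmetic progression, so the step
is constant on the face. -/
theorem IsTaitColoring.exists_hasDifferences (hR : R.IsPlaneTriangulation)
    {c : G.edgeSet → ZMod 3} (h : R.IsTaitColoring c) :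
    ∃ α : R.Face → (ZMod 3)ˣ, R.HasDifferences c fun F => α F := by
  have hne (d : G.Dart) : dartColor c (R.faceNext d) - dartColor c d ≠ 0 :=
    sub_ne_zero.2 (h _ _ (R.face_faceNext d) (R.edge_faceNext_ne hR.2 d))
  have hinv (d : G.Dart) : dartColor c (R.faceNext (R.faceNext d)) - dartColor c (R.faceNext d) =
      dartColor c (R.faceNext d) - dartColor c d := by
    have h1 := hne d
    have h2 := hne (R.faceNext d)
    have h3 : dartColor c (R.faceNext (R.faceNext d)) ≠ dartColor c d :=
      h _ _ (by simp only [face_faceNext]) (R.edge_faceNext_faceNext_ne hR.2 d)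
    revert h1 h2 h3
    generalize dartColor c (R.faceNext (R.faceNext d)) = x
    generalize dartColor c (R.faceNext d) = y
    generalize dartColor c d = z
    revert x y z
    decide
  refine ⟨Quotient.lift (s := Equiv.Perm.SameCycle.setoid R.faceNext)
    (fun d => Units.mk0 _ (hne d)) ?_, fun d => rfl⟩
  intro a b hab
  exact apply_eq_of_sameCycle (f := fun d => Units.mk0 _ (hne d))
    (fun d => Units.ext (hinv d)) hab

/-- Without edges there are no darts, hence no faces here, and at most one vertex: Euler's formula
fails. -/
theorem exists_edge (hR : R.IsPlanar) : Nonempty G.edgeSet := by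
  by_contra hE
  rw [not_nonempty_iff] at hE
  have hD : IsEmpty G.Dart := ⟨fun d => hE.false ⟨d.edge, d.edge_mem⟩⟩
  have hF : IsEmpty R.Face := ⟨fun F => hD.false (R.face_surjective F).choose⟩
  have hV : Subsingleton V :=
    ⟨fun u v => eq_of_preconnected hR.1.preconnected (p := id) (fun d => hD.elim d) u v⟩
  have h1 := hR.2
  have h2 : Nat.card V ≤ 1 := by
    rw [Nat.card_eq_fintype_card]
    exact Fintype.card_le_one_iff_subsingleton.2 hV
  rw [Nat.card_of_isEmpty (α := R.Face)] at h1
  omega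

/-- Heawood's description of the Tait colorings. -/
theorem tait_eq (hR : R.IsPlaneTriangulation) :
    R.tait = 3 * Nat.card {α : R.Face → (ZMod 3)ˣ // R.IsHeawood fun F => α F} := by
  obtain ⟨e₀⟩ := R.exists_edge hR.1
  have hG := hR.1.1.preconnected
  have hα (c : {c : G.edgeSet → Fin 3 // R.IsTaitColoring c}) :=
    IsTaitColoring.exists_hasDifferences R hR (c := c.1) c.2
  choose A hA using hα
  have hA' (c) : R.HasDifferences c.1 fun F => A c F := hA c
  -- The differences determine a coloring up to a global additive constant, fixed by the color of
  -- `e₀`; this is the factor 3.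
  let Φ : {c : G.edgeSet → Fin 3 // R.IsTaitColoring c} →
      ZMod 3 × {α : R.Face → (ZMod 3)ˣ // R.IsHeawood fun F => α F} :=
    fun c => (c.1 e₀, ⟨A c, (hA' c).isHeawood⟩)
  have hΦ : Function.Bijective Φ := by
    constructor
    · intro c c' h
      obtain ⟨h1, h2⟩ := Prod.ext_iff.1 h
      have h2' : A c = A c' := congrArg Subtype.val h2
      have hc' := hA' c'
      rw [← h2'] at hc'
      refine Subtype.ext (funext fun e => ?_)
      have h3 := HasDifferences.exists_eq_add R hG (hA' c) hc' e e₀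
      have h4 : (c.1 e₀ : ZMod 3) = c'.1 e₀ := h1
      exact sub_eq_zero.1 (h3.trans (sub_eq_zero.2 h4))
    · rintro ⟨k, α, hα⟩
      obtain ⟨c, hc⟩ := IsHeawood.exists_hasDifferences R hR hα
      let c' : G.edgeSet → ZMod 3 := fun e => c e + (k - c e₀)
      have hc' : R.HasDifferences c' fun F => α F := by
        intro d
        rw [← hc d]
        simp only [dartColor, c']
        ring
      refine ⟨⟨c', HasDifferences.isTaitColoring R hR hc'⟩, ?_⟩
      refine Prod.ext ?_ (Subtype.ext (funext fun F => Units.ext ?_))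
      · change c e₀ + (k - c e₀) = k
        ring
      · obtain ⟨d, rfl⟩ := R.face_surjective F
        exact (hA' ⟨c', _⟩ d).symm.trans (hc' d)
  rw [tait, Nat.card_congr (Equiv.ofBijective Φ hΦ), Nat.card_prod, Nat.card_zmod]

end RotationSystem

/-! ### Summation over the face signs. -/

theorem sum_ψ_mul (b : ZMod 3) : ∑ t : ZMod 3, ψ (t * b) = if b = 0 then 3 else 0 := by
  have := AddChar.sum_mulShift b (ZMod.isPrimitive_stdAddChar 3)
  rw [ψ, this]
  split_ifs <;> simp

theorem sum_ψ_dotProduct {V : Type*} [Fintype V] [DecidableEq V] (h : V → ZMod 3) :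
    ∑ y : V → ZMod 3, ψ (∑ v, y v * h v) = if ∀ v, h v = 0 then 3 ^ Fintype.card V else 0 := by
  simp_rw [ψ_sum]
  have := Finset.prod_univ_sum (fun _ : V => (univ : Finset (ZMod 3)))
    (fun v t => ψ (t * h v))
  rw [Fintype.piFinset_univ] at this
  rw [← this]
  simp_rw [sum_ψ_mul]
  split_ifs with h0
  · rw [prod_congr rfl fun v _ => if_pos (h0 v), prod_const, card_univ]
  · obtain ⟨v, hv⟩ := not_forall.1 h0
    exact prod_eq_zero (mem_univ v) (if_neg hv)

/-- For nonzero `t` both -t² and `t` are units, and a unit factor only permutes the two terms. -/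
theorem sum_units_ψ (t : ZMod 3) :
    ∑ u : (ZMod 3)ˣ, ψ (u * -(t ^ 2)) = ∑ u : (ZMod 3)ˣ, ψ (u * t) := by
  have hu : (univ : Finset (ZMod 3)ˣ) = {1, -1} := by decide
  have h3 : t = 0 ∨ t = 1 ∨ t = -1 := by revert t; decide
  rw [hu, sum_pair (by decide), sum_pair (by decide)]
  rcases h3 with rfl | rfl | rfl
  · simp
  · simp [add_comm]
  · simp

theorem sum_signs_ψ {F : Type*} [Fintype F] [DecidableEq F] (t : F → ZMod 3) :
    ∑ α : F → (ZMod 3)ˣ, ψ (∑ f, α f * -(t f ^ 2)) = ∑ α : F → (ZMod 3)ˣ, ψ (∑ f, α f * t f) := by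
  simp_rw [ψ_sum]
  have h1 := Finset.prod_univ_sum (fun _ : F => (univ : Finset (ZMod 3)ˣ))
    (fun f u => ψ (u * -(t f ^ 2)))
  have h2 := Finset.prod_univ_sum (fun _ : F => (univ : Finset (ZMod 3)ˣ))
    (fun f u => ψ (u * t f))
  rw [Fintype.piFinset_univ] at h1 h2
  rw [← h1, ← h2]
  simp_rw [sum_units_ψ]

/-- The numerator is an integer and the base of the denominator is purely imaginary. -/
theorem conj_weight {V : Type*} [Fintype V] (G : SimpleGraph V) (x : Sym2 V → ZMod 3)
    (W : Finset V) : (starRingEnd ℂ) (weight G x W) =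
      (-1) ^ (contractOrder G W - 1) * weight G x W := by
  have h : (starRingEnd ℂ) (-Complex.I * (Real.sqrt 3 : ℂ)) =
      (-1) * (-Complex.I * (Real.sqrt 3 : ℂ)) := by
    rw [map_mul, map_neg, Complex.conj_I, Complex.conj_ofReal]
    ring
  have h1 : ((-1 : ℂ) ^ (contractOrder G W - 1))⁻¹ = (-1) ^ (contractOrder G W - 1) := by
    rw [← inv_pow]
    norm_num
  rw [weight, map_div₀, map_pow, h, mul_pow, div_mul_eq_div_div_swap, map_intCast,
    div_eq_mul_inv _ ((-1 : ℂ) ^ _), h1, mul_comm]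

theorem IsMinContraction.contractOrder_pos {V : Type*} [Fintype V] [Nonempty V]
    {G : SimpleGraph V} {x : Sym2 V → ZMod 3} {W : Finset V} (h : IsMinContraction G x W) :
    0 < contractOrder G W := by
  classical
  obtain ⟨W₁, hne, -, hord, -⟩ := h.exists_nonempty
  rw [hord, contractOrder_of_nonempty hne]
  exact Nat.succ_pos _

namespace RotationSystem

variable {V : Type*} [Fintype V] [DecidableEq V] {G : SimpleGraph V} (R : RotationSystem G)

theorem restrictWeight_edgeWeight (α : R.Face → (ZMod 3)ˣ) :
    restrictWeight G (R.edgeWeight α) = R.edgeWeight α := by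
  ext e
  rw [restrictWeight]
  split_ifs with h
  · rfl
  · refine (sum_eq_zero fun d hd => ?_).symm
    have hde : d.edge = e := by simpa using hd
    exact absurd (hde ▸ d.edge_mem) h

open Classical in
theorem dotProduct_laplacian_edgeWeight (α : R.Face → (ZMod 3)ˣ) (y : V → ZMod 3) :
    y ⬝ᵥ laplacian G (R.edgeWeight α) *ᵥ y =
      ∑ d : G.Dart, (α (R.face d) : ZMod 3) * (y d.fst - y d.snd) ^ 2 := by
  rw [dotProduct_laplacian_mulVec, restrictWeight_edgeWeight,
    ← sum_fiberwise univ (fun d : G.Dart => d.edge)]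
  refine sum_congr rfl fun e _ => ?_
  rw [edgeWeight, sum_mul]
  refine sum_congr (by ext; simp) fun d hd => ?_
  rw [← (mem_filter.1 hd).2]
  exact congrArg _ (endDiff_mk_sq d.fst d.snd y)

open Classical in
/-- The sum of the values of `y` at the vertices of a face. -/
noncomputable def faceSum (y : V → ZMod 3) (F : R.Face) : ZMod 3 :=
  ∑ d : G.Dart with R.face d = F, y d.fst

/-- Each edge term is shared between its two darts and regrouped by faces; then (a-b)² + (b-c)² +
(c-a)² = -(a+b+c)² mod 3. -/
theorem dotProduct_laplacian_eq_sum_faces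
    (hF : ∀ F : R.Face, {d : G.Dart | R.face d = F}.ncard = 3)
    (α : R.Face → (ZMod 3)ˣ) (y : V → ZMod 3) :
    y ⬝ᵥ laplacian G (R.edgeWeight α) *ᵥ y =
      ∑ F, (α F : ZMod 3) * -(R.faceSum y F ^ 2) := by
  classical
  rw [dotProduct_laplacian_edgeWeight, ← sum_fiberwise univ R.face]
  refine sum_congr rfl fun F _ => ?_
  rw [sum_congr rfl (g := fun d : G.Dart => (α F : ZMod 3) * (y d.fst - y d.snd) ^ 2)
    (fun d hd => by rw [(mem_filter.1 hd).2]), ← mul_sum]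
  congr 1
  obtain ⟨d, rfl⟩ := R.face_surjective F
  rw [faceSum, R.sum_face hF, R.sum_face hF, fst_faceNext, fst_faceNext,
    R.snd_faceNext_faceNext hF, ← fst_faceNext R (R.faceNext d)]
  generalize y d.fst = a
  generalize y d.snd = b
  generalize y (R.faceNext (R.faceNext d)).fst = c
  revert a b c
  decide

open Classical in
theorem sum_mul_faceSum (α : R.Face → ZMod 3) (y : V → ZMod 3) :
    ∑ F, α F * R.faceSum y F = ∑ v, y v * ∑ d : G.Dart with d.fst = v, α (R.face d) := by
  simp_rw [faceSum, mul_sum]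
  trans ∑ d : G.Dart, α (R.face d) * y d.fst
  · rw [← sum_fiberwise univ R.face]
    refine sum_congr rfl fun F _ => sum_congr rfl fun d hd => ?_
    rw [(mem_filter.1 hd).2]
  · rw [← sum_fiberwise univ (fun d : G.Dart => d.fst)]
    refine sum_congr rfl fun v _ => sum_congr rfl fun d hd => ?_
    rw [(mem_filter.1 hd).2, mul_comm]

/-- For fixed `y` the signs linearize the exponent; for fixed α the sum over `y` is then a character
sum that detects the vertex conditions. -/
theorem sum_gauss_eq_card_heawood
    (hF : ∀ F : R.Face, {d : G.Dart | R.face d = F}.ncard = 3) :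
    ∑ α : R.Face → (ZMod 3)ˣ, ∑ y : V → ZMod 3, ψ (y ⬝ᵥ laplacian G (R.edgeWeight α) *ᵥ y) =
      3 ^ Fintype.card V * Nat.card {α : R.Face → (ZMod 3)ˣ // R.IsHeawood fun F => α F} := by
  classical
  rw [sum_comm]
  simp_rw [R.dotProduct_laplacian_eq_sum_faces hF, sum_signs_ψ]
  rw [sum_comm]
  simp_rw [R.sum_mul_faceSum (fun F => ((_ : R.Face → (ZMod 3)ˣ) F : ZMod 3)), sum_ψ_dotProduct]
  rw [← sum_filter, sum_const, nsmul_eq_mul, mul_comm, Nat.card_eq_fintype_card,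
    Fintype.card_subtype]
  congr!
  exact ⟨fun h v => by convert h v, fun h v => by convert h v⟩

end RotationSystem

end TaitAlpha

/-! ### The coloring formula. -/

theorem theorem1 {V : Type*} [Fintype V] (G : SimpleGraph V)
    (R : TaitAlpha.RotationSystem G) (hR : R.IsPlaneTriangulation) :
    -- a minimal contraction set exists for every weight vector
    (∀ x : Sym2 V → ZMod 3, ∃ W : Finset V, TaitAlpha.IsMinContraction G x W) ∧
    -- the weight of a vector does not depend on the choice of the minimal contraction set
    (∀ (x : Sym2 V → ZMod 3) (W W' : Finset V),
      TaitAlpha.IsMinContraction G x W → TaitAlpha.IsMinContraction G x W' →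
        TaitAlpha.contractOrder G W = TaitAlpha.contractOrder G W' ∧
        TaitAlpha.weight G x W = TaitAlpha.weight G x W') ∧
    -- the formula for the number of Tait colorings, whatever the choice of these sets
    (∀ Wstar : (R.Face → (ZMod 3)ˣ) → Finset V,
      (∀ α, TaitAlpha.IsMinContraction G (R.edgeWeight α) (Wstar α)) →
        (R.tait : ℂ) / 3 =
          ∑ α : R.Face → (ZMod 3)ˣ with Odd (TaitAlpha.contractOrder G (Wstar α)),
            TaitAlpha.weight G (R.edgeWeight α) (Wstar α)) := by
  classical
  have hne : Nonempty V := hR.1.1.nonempty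
  refine ⟨fun x => TaitAlpha.exists_isMinContraction x,
    fun x W W' h h' => ⟨h.contractOrder_eq h', h.weight_eq.trans h'.weight_eq.symm⟩,
    fun Wstar hW => ?_⟩
  -- The sum over all α, without the parity restriction, is already the real number sought; parity
  -- enters only through real parts.
  have htotal : ∑ α, TaitAlpha.weight G (R.edgeWeight α) (Wstar α) = (R.tait : ℂ) / 3 := by
    rw [Finset.sum_congr rfl fun α _ => (hW α).weight_eq, ← Finset.sum_div,
      R.sum_gauss_eq_card_heawood hR.2, R.tait_eq hR]
    push_cast
    rw [mul_div_cancel_left₀ _ (pow_ne_zero _ (by norm_num)),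
      mul_div_cancel_left₀ _ (by norm_num)]
  have hodd (α) (h : Odd (TaitAlpha.contractOrder G (Wstar α))) :
      TaitAlpha.weight G (R.edgeWeight α) (Wstar α) =
        ((TaitAlpha.weight G (R.edgeWeight α) (Wstar α)).re : ℂ) := by
    rw [eq_comm, ← Complex.conj_eq_iff_re, TaitAlpha.conj_weight,
      (Nat.Odd.sub_odd h odd_one).neg_one_pow, one_mul]
  have heven (α) (h : ¬ Odd (TaitAlpha.contractOrder G (Wstar α))) :
      (TaitAlpha.weight G (R.edgeWeight α) (Wstar α)).re = 0 := by
    have h1 := congrArg Complex.re (TaitAlpha.conj_weight G (R.edgeWeight α) (Wstar α))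
    -- Positivity of the order makes the truncated subtraction genuine, so an even order gives an
    -- odd exponent.
    rw [(Nat.Even.sub_odd (hW α).contractOrder_pos (Nat.not_odd_iff_even.1 h)
      odd_one).neg_one_pow, Complex.conj_re, neg_one_mul, Complex.neg_re] at h1
    linarith
  have hre := congrArg Complex.re htotal
  rw [Complex.re_sum, ← Finset.sum_filter_add_sum_filter_not Finset.univ
    (fun α => Odd (TaitAlpha.contractOrder G (Wstar α))),
    Finset.sum_eq_zero (s := Finset.univ.filter fun α => ¬ _)
      (fun α hα => heven α (Finset.mem_filter.1 hα).2), add_zero] at hre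
  have hcast : ((R.tait : ℂ) / 3) = ((((R.tait : ℂ) / 3).re : ℝ) : ℂ) := by
    rw [show ((R.tait : ℂ) / 3) = ((R.tait / 3 : ℝ) : ℂ) by push_cast; rfl, Complex.ofReal_re]
  rw [hcast, ← hre, Complex.ofReal_sum]
  refine Finset.sum_congr (by congr!) fun α hα => ?_
  exact (hodd α (by simpa using hα)).symm
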